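/- **Setting.** Let $(G,V,\|\cdot\|)$ be a sub-Finsler Lie group: $G$ is a (finite-dimensional, real) Lie group with Lie algebra $\mathfrak g$, $V\subseteq\mathfrak g$ is a linear subspace that generates $\mathfrak g$ as a Lie algebra, and $\|\cdot\|$ is a norm on $V$. Assume that $\|\cdot\|$ is polyhedral, i.e. its closed unit ball is the convex hull of finitely many points. Let $\mathrm E(v)=\tfrac12\|v\|^2$, and let $\partial_u\mathrm E=\{\eta\in V^*:\eta(v-u)\le \mathrm E(v)-\mathrm E(u)\ \forall v\in V\}$ be its subdifferential at $u$. An absolutely continuous curve $\gamma:[0,1]\to G$ is horizontal with control $u:[0,1]\to V$ if $\dot\gamma(t)=\mathrm dL_{\gamma(t)}u(t)$ for a.e. $t$. Let $d(g,h)\in[0,\infty]$ be the infimum of $\int_0^1\|u(t)\|\,\mathrm dt$ over horizontal curves from $g$ to $h$ (with control $u$), and let $\bar B(1_G,r)=\{g\in G:d(1_G,g)\le r\}$. A horizontal curve $\gamma$ with control $u\in L^2([0,1],V)$ is a normal curve with associated covector $\lambda\in\mathfrak g^*$ if $\lambda\circ\mathrm{Ad}_{\gamma(t)}|_V\in\partial_{u(t)}\mathrm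 E$ for a.e. $t\in[0,1]$; it is a normal curve if it has some associated covector. It has speed $r$ if $\|u(t)\|=r$ for a.e. $t$. A face of the sphere of radius $\rho>0$ is a set $\{v\in V:\|v\|\le\rho,\ \eta(v)=\max_{\|w\|\le\rho}\eta(w)\}$ with $\eta\in V^*\setminus\{0\}$. The control $u$ takes values in one face on an interval $I$ if there are $\rho>0$ and a face $A$ of the sphere of radius $\rho$ such that $u(t)\in A$ for a.e. $t\in I$. **Theorem.** (i) For each non-constant normal curve $\gamma:[0,1]\to G$ there exists $\delta'>0$ such that on each interval $I\subseteq[0,1]$ with $|I|\le\delta'$ the control of $\gamma$ takes values in one face. (ii) Fix a norm $N$ on $\mathfrak g$ and a norm $N^*$ on $\mathfrak g^*$, and for $r>0$ set $$M(r):=\sup\{N(\mathrm{Ad}_g\,\mathrm{ad}_XY): g\in\bar B(1_G,r),\ X,Y\in\mathfrak g,\ N(X)=N(Y)=1\}$$ (with $M(r)=0$ if $\mathfrak g=0$). Then $M(r)<\infty$ for every $r>0$, and there exists $\delta>0$ such that for every $r>0$, each normal curve $\gamma:[0,1]\to G$ with $\gamma(0)=1_G$ and speed $r$, each covector $\lambda$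 associated to $\gamma$, and every interval $I\subseteq[0,1]$ with $|I|\,N^*(\lambda)\,M(r)\le\delta$, the control of $\gamma$ takes values in one face on $I$. -/

import Mathlib

open MeasureTheory Set
open scoped Manifold ContDiff ENNReal

noncomputable section

/-! ### Convex analysis -/

section Convex

variable {W : Type*} [AddCommGroup W] [Module ℝ W]

/-- A norm on a real vector space, presented as a definite seminorm. -/
def IsNorm (p : Seminorm ℝ W) : Prop := ∀ v, p v = 0 → v = 0

/-- The closed unit ball of `p` is the convex hull of finitely many points. -/
def IsPolyhedral (p : Seminorm ℝ W) : Prop :=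
  ∃ s : Finset W, {v | p v ≤ 1} = convexHull ℝ (s : Set W)

/-- The energy of a norm. -/
def energy (p : Seminorm ℝ W) (v : W) : ℝ := (1 / 2) * p v ^ 2

/-- The subdifferential of `f` at `u`. -/
def subdifferential (f : W → ℝ) (u : W) : Set (Module.Dual ℝ W) :=
  {η | ∀ v, η (v - u) ≤ f v - f u}

/-- `F` is a face of the boundary of `K`: the set of points of `K` where some nonzero linear
functional attains its maximum over `K`. -/
def IsFace (K F : Set W) : Prop :=
  ∃ η : Module.Dual ℝ W, η ≠ 0 ∧ F = {v ∈ K | ∀ w ∈ K, η w ≤ η v}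

/-- For almost every `t ∈ [a, b]` the vector `u t` lies in one and the same face of a sphere of
positive radius of the norm `p`. -/
def TakesValueInFace (p : Seminorm ℝ W) (u : ℝ → W) (a b : ℝ) : Prop :=
  ∃ r : ℝ, 0 < r ∧ ∃ F : Set W, IsFace {v | p v ≤ r} F ∧ ∀ᵐ t ∂volume.restrict (Icc a b), u t ∈ F

end Convex

/-! ### Sub-Finsler Lie groups -/

section LieGroups

variable {E : Type*} [NormedAddCommGroup E] [NormedSpace ℝ E]
  {G : Type*} [TopologicalSpace G] [ChartedSpace E G] [Group G]

/-- The adjoint map `Ad_g`, the differential at the identity of `x ↦ g x g⁻¹`. -/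
def Ad (g : G) : GroupLieAlgebra 𝓘(ℝ, E) G →L[ℝ] GroupLieAlgebra 𝓘(ℝ, E) G :=
  mfderiv 𝓘(ℝ, E) 𝓘(ℝ, E) (fun x : G => g * x * g⁻¹) 1

/-- The Lie algebra generated by `V` is the whole Lie algebra of `G`. -/
def IsBracketGenerating [FiniteDimensional ℝ E] [LieGroup 𝓘(ℝ, E) ∞ G]
    (V : Submodule ℝ (GroupLieAlgebra 𝓘(ℝ, E) G)) : Prop :=
  haveI : CompleteSpace E := FiniteDimensional.complete ℝ E
  haveI : LieGroup 𝓘(ℝ, E) (minSmoothness ℝ 3) G :=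
    LieGroup.of_le (n := ∞) (by simpa using ENat.LEInfty.out)
  LieSubalgebra.lieSpan ℝ (GroupLieAlgebra 𝓘(ℝ, E) G) (V : Set (GroupLieAlgebra 𝓘(ℝ, E) G)) = ⊤

variable (E) in
/-- Absolute continuity of a curve `[0, 1] → G`: it is continuous, and it is absolutely continuous
in each chart, on each compact interval that it maps to the domain of that chart. -/
def IsACCurve (γ : ℝ → G) : Prop :=
  ContinuousOn γ (Icc 0 1) ∧
    ∀ (x : G) (a b : ℝ), 0 ≤ a → a ≤ b → b ≤ 1 → MapsTo γ (Icc a b) (chartAt E x).source →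
      AbsolutelyContinuousOnInterval (fun t => chartAt E x (γ t)) a b

/-- `γ : [0, 1] → G` is a horizontal curve for the polarization `V`, with control `u`, that is,
`γ` is absolutely continuous and `γ'(t) = dL_{γ(t)} u(t)` with `u(t) ∈ V` for almost every `t`.
Only the values of `γ` and `u` on `[0, 1]` matter. -/
structure IsHorizontal (V : Submodule ℝ (GroupLieAlgebra 𝓘(ℝ, E) G)) (γ : ℝ → G) (u : ℝ → V) :
    Prop where
  ac : IsACCurve E γ
  measurable : AEStronglyMeasurable u (volume.restrict (Icc 0 1))
  deriv : ∀ᵐ t ∂volume.restrict (Icc (0 : ℝ) 1), HasMFDerivAt 𝓘(ℝ, ℝ) 𝓘(ℝ, E) γ t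
    ((1 : ℝ →L[ℝ] ℝ).smulRight
      (mulInvariantVectorField (u t : GroupLieAlgebra 𝓘(ℝ, E) G) (γ t)))

/-- The Carnot-Carathéodory distance, with values in `[0, ∞]`. -/
def ccDist (V : Submodule ℝ (GroupLieAlgebra 𝓘(ℝ, E) G)) (p : Seminorm ℝ V) (g h : G) : ℝ≥0∞ :=
  ⨅ (γ : ℝ → G) (u : ℝ → V) (_ : IsHorizontal V γ u) (_ : γ 0 = g) (_ : γ 1 = h),
    ∫⁻ t in Icc (0 : ℝ) 1, ENNReal.ofReal (p (u t))

/-- `γ : [0, 1] → G` is horizontal with control `u ∈ L²([0, 1], V)`, and the covector `l` satisfies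
the normal inclusion along `γ`. -/
structure IsNormalWithCovector (V : Submodule ℝ (GroupLieAlgebra 𝓘(ℝ, E) G)) (p : Seminorm ℝ V)
    (γ : ℝ → G) (u : ℝ → V) (l : Module.Dual ℝ (GroupLieAlgebra 𝓘(ℝ, E) G)) : Prop where
  horizontal : IsHorizontal V γ u
  memLp : MemLp (fun t => p (u t)) 2 (volume.restrict (Icc 0 1))
  inclusion : ∀ᵐ t ∂volume.restrict (Icc (0 : ℝ) 1),
    l ∘ₗ (Ad (γ t)).toLinearMap ∘ₗ V.subtype ∈ subdifferential (energy p) (u t)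

/-- `γ : [0, 1] → G` is a normal curve with control `u`. -/
def IsNormalCurve (V : Submodule ℝ (GroupLieAlgebra 𝓘(ℝ, E) G)) (p : Seminorm ℝ V)
    (γ : ℝ → G) (u : ℝ → V) : Prop :=
  ∃ l : Module.Dual ℝ (GroupLieAlgebra 𝓘(ℝ, E) G), IsNormalWithCovector V p γ u l

/-- The numbers `N (Ad_g ad_X Y)` with `g` in the closed ball of radius `r` around the identity
and `N X = N Y = 1`. -/
def adjointValues (V : Submodule ℝ (GroupLieAlgebra 𝓘(ℝ, E) G)) (p : Seminorm ℝ V)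
    (N : Seminorm ℝ (GroupLieAlgebra 𝓘(ℝ, E) G)) (r : ℝ) : Set ℝ :=
  {c | ∃ (g : G) (X Y : GroupLieAlgebra 𝓘(ℝ, E) G), ccDist V p 1 g ≤ ENNReal.ofReal r ∧
    N X = 1 ∧ N Y = 1 ∧ c = N (Ad g ⁅X, Y⁆)}

/-- `M(r)`, the maximum of `N (Ad_g ad_X Y)` over `g` in the closed ball of radius `r` around the
identity and `N X = N Y = 1`. -/
def adjointBound (V : Submodule ℝ (GroupLieAlgebra 𝓘(ℝ, E) G)) (p : Seminorm ℝ V)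
    (N : Seminorm ℝ (GroupLieAlgebra 𝓘(ℝ, E) G)) (r : ℝ) : ℝ :=
  sSup (adjointValues V p N r)

end LieGroups

end

/-! ### The adjoint representation is C¹, and its derivative at the identity is the bracket. -/

section AdjointRepresentation

open Filter Topology

variable {E : Type*} [NormedAddCommGroup E] [NormedSpace ℝ E]
  {G : Type*} [TopologicalSpace G] [ChartedSpace E G] [Group G]

/-! Write η(t) for λ ∘ Ad_γ(t) restricted to V. The normal inclusion says that the dual norm of η(t)
is ‖u(t)‖ and that η(t)(u(t)) = ‖u(t)‖², so u(t), if nonzero, lies in the face exposed by η(t).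
Along a horizontal curve d/dt Ad_γ = Ad_γ ∘ ad_u (`hasDerivAt_modelAd`), so η'(t)(v) = λ(Ad_γ(t)
[u(t), v]) for a.e. t. This vanishes for v = u(t), and an envelope argument makes the dual norm of η
a constant r (`exists_forall_sup'_apply_eq`). Hence ‖u‖ = r almost everywhere.

For a polyhedral ball the dual norm is a maximum over the finite set s of points spanning the ball.
By compactness, and because s has finitely many subsets, there is δ > 0 such that whenever a
functional of dual norm one is δ-almost maximal on a subset of s, some functional of dual norm one
is exactly maximal there (`exists_pos_forall_subset_exists_eq_one`). So if η oscillates by at most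
δr on an interval, all the faces exposed by η(t) there lie in a single face
(`exists_pos_takesValueInFace`).

It remains to bound the oscillation. In (i), η is uniformly continuous, and r > 0 because γ is not
constant. In (ii), the derivative of η on s is at most a constant times N*(λ) M(r) r; the factor r
cancels against the tolerance δr, so the threshold does not depend on r. Finiteness of M(r) follows
from a Grönwall estimate for Ad along horizontal curves of bounded length
(`exists_norm_modelAd_le`). -/

theorem Ad_one : Ad (1 : G) = ContinuousLinearMap.id ℝ (GroupLieAlgebra 𝓘(ℝ, E) G) := by
  have : (fun x : G => 1 * x * 1⁻¹) = id := by ext x; simp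
  have h := mfderiv_id (I := 𝓘(ℝ, E)) (x := (1 : G))
  rw [← this] at h
  exact h

variable (E G) in
/-- The product of the group read in the chart at the identity. -/
noncomputable def chartMul (q : E × E) : E :=
  extChartAt 𝓘(ℝ, E) (1 : G)
    ((extChartAt 𝓘(ℝ, E) (1 : G)).symm q.1 * (extChartAt 𝓘(ℝ, E) (1 : G)).symm q.2)

variable (E G) in
/-- The coordinate of the identity in the chart at the identity. -/
noncomputable def chartOne : E := extChartAt 𝓘(ℝ, E) (1 : G) 1

theorem extChartAt_symm_chartOne : (extChartAt 𝓘(ℝ, E) (1 : G)).symm (chartOne E G) = 1 :=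
  extChartAt_to_inv (I := 𝓘(ℝ, E)) (1 : G)

theorem extChartAt_target_mem_nhds_chartOne :
    (extChartAt 𝓘(ℝ, E) (1 : G)).target ∈ 𝓝 (chartOne E G) :=
  extChartAt_target_mem_nhds (I := 𝓘(ℝ, E)) (1 : G)

variable {M M' : Type*} [TopologicalSpace M] [ChartedSpace E M] [TopologicalSpace M']
  [ChartedSpace E M'] in
/-- The derivative of a map between manifolds modelled on `E`, with the tangent spaces identified
with `E`. -/
noncomputable def modelDeriv (f : M → M') (x : M) : E →L[ℝ] E := mfderiv 𝓘(ℝ, E) 𝓘(ℝ, E) f x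

/-- The adjoint map, with the Lie algebra identified with `E`. -/
noncomputable def modelAd (g : G) : E →L[ℝ] E := Ad g

variable (E G) in
/-- The adjoint representation read in the chart at the identity. -/
noncomputable def chartAd (a : E) : E →L[ℝ] E := modelAd ((extChartAt 𝓘(ℝ, E) (1 : G)).symm a)

variable (E G) in
/-- The Lie bracket of the Lie algebra of `G`, with the Lie algebra identified with `E`. -/
noncomputable def modelBracket (X Y : GroupLieAlgebra 𝓘(ℝ, E) G) : E :=
  (⁅X, Y⁆ : GroupLieAlgebra 𝓘(ℝ, E) G)

variable [LieGroup 𝓘(ℝ, E) ∞ G]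

theorem mdifferentiableAt_leftMul (g x : G) :
    MDifferentiableAt 𝓘(ℝ, E) 𝓘(ℝ, E) (fun y : G => g * y) x :=
  (contMDiff_mul_left (I := 𝓘(ℝ, E)) (n := ∞) (a := g)).mdifferentiableAt (by simp)

theorem mdifferentiableAt_rightMul (g x : G) :
    MDifferentiableAt 𝓘(ℝ, E) 𝓘(ℝ, E) (fun y : G => y * g) x :=
  (contMDiff_mul_right (I := 𝓘(ℝ, E)) (n := ∞) (a := g)).mdifferentiableAt (by simp)

theorem mdifferentiableAt_conj (g x : G) :
    MDifferentiableAt 𝓘(ℝ, E) 𝓘(ℝ, E) (fun y : G => g * y * g⁻¹) x :=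
  (mdifferentiableAt_rightMul g⁻¹ (g * x)).comp x (mdifferentiableAt_leftMul g x)

theorem Ad_mul_apply (g h : G) (v : GroupLieAlgebra 𝓘(ℝ, E) G) :
    Ad (g * h) v = Ad g (Ad h v) := by
  have : (fun x : G => g * h * x * (g * h)⁻¹) =
      (fun x : G => g * x * g⁻¹) ∘ fun x : G => h * x * h⁻¹ := by
    ext x; simp [mul_assoc]
  have key := mfderiv_comp_apply_of_eq (x := (1 : G)) (y := (1 : G))
    (mdifferentiableAt_conj (E := E) g 1) (mdifferentiableAt_conj (E := E) h 1) (by simp) v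
  rw [← this] at key
  exact key

/-- `dR_g ∘ Ad_g = dL_g`. -/
theorem mfderiv_mul_right_Ad (g : G) (v : GroupLieAlgebra 𝓘(ℝ, E) G) :
    (mfderiv 𝓘(ℝ, E) 𝓘(ℝ, E) (fun x : G => x * g) 1 (Ad g v) : E) =
      mulInvariantVectorField v g := by
  have : (fun x : G => g * x) = (fun x : G => x * g) ∘ fun x : G => g * x * g⁻¹ := by
    ext x; simp [mul_assoc]
  have key := mfderiv_comp_apply_of_eq (x := (1 : G)) (y := (1 : G))
    (mdifferentiableAt_rightMul (E := E) g 1) (mdifferentiableAt_conj (E := E) g 1) (by simp) v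
  rw [← this] at key
  exact key.symm

theorem contDiffAt_chartMul : ContDiffAt ℝ ∞ (chartMul E G) (chartOne E G, chartOne E G) := by
  rw [← contMDiffAt_iff_contDiffAt]
  have hs : ContMDiffAt 𝓘(ℝ, E) 𝓘(ℝ, E) ∞ (extChartAt 𝓘(ℝ, E) (1 : G)).symm (chartOne E G) :=
    (contMDiffOn_extChartAt_symm (1 : G)).contMDiffAt extChartAt_target_mem_nhds_chartOne
  have h1 : ContMDiffAt 𝓘(ℝ, E × E) 𝓘(ℝ, E) ∞
      (fun q : E × E => (extChartAt 𝓘(ℝ, E) (1 : G)).symm q.1) (chartOne E G, chartOne E G) :=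
    ContMDiffAt.comp (chartOne E G, chartOne E G) (g := (extChartAt 𝓘(ℝ, E) (1 : G)).symm)
      (f := Prod.fst) hs contDiff_fst.contMDiff.contMDiffAt
  have h2 : ContMDiffAt 𝓘(ℝ, E × E) 𝓘(ℝ, E) ∞
      (fun q : E × E => (extChartAt 𝓘(ℝ, E) (1 : G)).symm q.2) (chartOne E G, chartOne E G) :=
    ContMDiffAt.comp (chartOne E G, chartOne E G) (g := (extChartAt 𝓘(ℝ, E) (1 : G)).symm)
      (f := Prod.snd) hs contDiff_snd.contMDiff.contMDiffAt
  refine ContMDiffAt.comp (chartOne E G, chartOne E G) (g := extChartAt 𝓘(ℝ, E) (1 : G))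
    (f := fun q : E × E => (extChartAt 𝓘(ℝ, E) (1 : G)).symm q.1 *
      (extChartAt 𝓘(ℝ, E) (1 : G)).symm q.2) ?_ (h1.mul h2)
  simp only [extChartAt_symm_chartOne, mul_one]
  exact contMDiffAt_extChartAt

/-- The tangent space at 1 is identified with E through this very chart, so the derivative is the
identity. -/
theorem hasMFDerivAt_extChartAt_symm_chartOne :
    HasMFDerivAt 𝓘(ℝ, E) 𝓘(ℝ, E) (extChartAt 𝓘(ℝ, E) (1 : G)).symm (chartOne E G)
      (ContinuousLinearMap.id ℝ E) := by
  have : IsManifold 𝓘(ℝ, E) 1 G := inferInstance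
  have h : MDifferentiableAt 𝓘(ℝ, E) 𝓘(ℝ, E) (extChartAt 𝓘(ℝ, E) (1 : G)).symm (chartOne E G) :=
    ((contMDiffOn_extChartAt_symm (n := ∞) (1 : G)).contMDiffAt
      extChartAt_target_mem_nhds_chartOne).mdifferentiableAt (by simp)
  have h2 := mfderivWithin_range_extChartAt_symm (I := 𝓘(ℝ, E)) (x := (1 : G))
  have h3 := h.hasMFDerivAt
  rw [modelWithCornersSelf_coe, range_id, mfderivWithin_univ] at h2
  have h4 : mfderiv 𝓘(ℝ, E) 𝓘(ℝ, E) (extChartAt 𝓘(ℝ, E) (1 : G)).symm (chartOne E G) =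
    ContinuousLinearMap.id ℝ E := h2
  rwa [h4] at h3

theorem hasFDerivAt_chartMul_right {a : E} (ha : a ∈ (extChartAt 𝓘(ℝ, E) (1 : G)).target) :
    HasFDerivAt (fun b => chartMul E G (a, b))
      (modelDeriv (extChartAt 𝓘(ℝ, E) (1 : G)) ((extChartAt 𝓘(ℝ, E) (1 : G)).symm a) ∘L
        modelDeriv (fun x : G => (extChartAt 𝓘(ℝ, E) (1 : G)).symm a * x) 1) (chartOne E G) := by
  refine HasMFDerivAt.hasFDerivAt ?_
  set g := (extChartAt 𝓘(ℝ, E) (1 : G)).symm a with hg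
  have hgs : g ∈ (chartAt E (1 : G)).source := by
    rw [← extChartAt_source 𝓘(ℝ, E)]; exact (extChartAt 𝓘(ℝ, E) (1 : G)).map_target ha
  have h1 : HasMFDerivAt 𝓘(ℝ, E) 𝓘(ℝ, E) (fun x : G => g * x)
      ((extChartAt 𝓘(ℝ, E) (1 : G)).symm (chartOne E G)) (modelDeriv (E := E) (fun x : G => g * x) 1) := by
    rw [extChartAt_symm_chartOne]
    exact (mdifferentiableAt_leftMul g 1).hasMFDerivAt
  have h2 : HasMFDerivAt 𝓘(ℝ, E) 𝓘(ℝ, E) (extChartAt 𝓘(ℝ, E) (1 : G))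
      (g * (extChartAt 𝓘(ℝ, E) (1 : G)).symm (chartOne E G))
      (modelDeriv (E := E) (extChartAt 𝓘(ℝ, E) (1 : G)) g) := by
    rw [extChartAt_symm_chartOne, mul_one]
    exact (mdifferentiableAt_extChartAt hgs).hasMFDerivAt
  exact HasMFDerivAt.comp (chartOne E G) 
    (f := fun b => g * (extChartAt 𝓘(ℝ, E) (1 : G)).symm b) h2
    (h1.comp _ hasMFDerivAt_extChartAt_symm_chartOne)

theorem hasFDerivAt_chartMul_left {a : E} (ha : a ∈ (extChartAt 𝓘(ℝ, E) (1 : G)).target) :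
    HasFDerivAt (fun b => chartMul E G (b, a))
      (modelDeriv (extChartAt 𝓘(ℝ, E) (1 : G)) ((extChartAt 𝓘(ℝ, E) (1 : G)).symm a) ∘L
        modelDeriv (fun x : G => x * (extChartAt 𝓘(ℝ, E) (1 : G)).symm a) 1) (chartOne E G) := by
  refine HasMFDerivAt.hasFDerivAt ?_
  set g := (extChartAt 𝓘(ℝ, E) (1 : G)).symm a with hg
  have hgs : g ∈ (chartAt E (1 : G)).source := by
    rw [← extChartAt_source 𝓘(ℝ, E)]; exact (extChartAt 𝓘(ℝ, E) (1 : G)).map_target ha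
  have h1 : HasMFDerivAt 𝓘(ℝ, E) 𝓘(ℝ, E) (fun x : G => x * g)
      ((extChartAt 𝓘(ℝ, E) (1 : G)).symm (chartOne E G)) (modelDeriv (E := E) (fun x : G => x * g) 1) := by
    rw [extChartAt_symm_chartOne]
    exact (mdifferentiableAt_rightMul g 1).hasMFDerivAt
  have h2 : HasMFDerivAt 𝓘(ℝ, E) 𝓘(ℝ, E) (extChartAt 𝓘(ℝ, E) (1 : G))
      ((extChartAt 𝓘(ℝ, E) (1 : G)).symm (chartOne E G) * g)
      (modelDeriv (E := E) (extChartAt 𝓘(ℝ, E) (1 : G)) g) := by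
    rw [extChartAt_symm_chartOne, one_mul]
    exact (mdifferentiableAt_extChartAt hgs).hasMFDerivAt
  exact HasMFDerivAt.comp (chartOne E G) 
    (f := fun b => (extChartAt 𝓘(ℝ, E) (1 : G)).symm b * g) h2
    (h1.comp _ hasMFDerivAt_extChartAt_symm_chartOne)

theorem eventually_contDiffAt_chartMul :
    ∀ᶠ q in 𝓝 (chartOne E G, chartOne E G), ContDiffAt ℝ 2 (chartMul E G) q :=
  (contDiffAt_chartMul.of_le (by norm_cast)).eventually (by simp)

/-- Left invariant vector fields, read in the chart at the identity. -/
theorem eventually_fderiv_chartMul_inr :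
    ∀ᶠ a in 𝓝 (chartOne E G), ∀ X : E, fderiv ℝ (chartMul E G) (a, chartOne E G) (0, X) =
      modelDeriv (extChartAt 𝓘(ℝ, E) (1 : G)) ((extChartAt 𝓘(ℝ, E) (1 : G)).symm a)
        (modelDeriv (fun x : G => (extChartAt 𝓘(ℝ, E) (1 : G)).symm a * x) 1 X) := by
  have hc : Tendsto (fun a : E => (a, chartOne E G)) (𝓝 (chartOne E G))
      (𝓝 (chartOne E G, chartOne E G)) := by
    have : Continuous fun a : E => (a, chartOne E G) := by fun_prop
    exact this.tendsto _
  filter_upwards [hc.eventually eventually_contDiffAt_chartMul,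
    extChartAt_target_mem_nhds_chartOne (G := G)] with a ha hat X
  have h1 := (ha.differentiableAt (by simp)).hasFDerivAt.comp (chartOne E G)
    (hasFDerivAt_prodMk_right a (chartOne E G))
  have h2 := h1.unique (hasFDerivAt_chartMul_right hat)
  exact DFunLike.congr_fun h2 X

/-- Right invariant vector fields, read in the chart at the identity. -/
theorem eventually_fderiv_chartMul_inl :
    ∀ᶠ a in 𝓝 (chartOne E G), ∀ X : E, fderiv ℝ (chartMul E G) (chartOne E G, a) (X, 0) =
      modelDeriv (extChartAt 𝓘(ℝ, E) (1 : G)) ((extChartAt 𝓘(ℝ, E) (1 : G)).symm a)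
        (modelDeriv (fun x : G => x * (extChartAt 𝓘(ℝ, E) (1 : G)).symm a) 1 X) := by
  have hc : Tendsto (fun a : E => (chartOne E G, a)) (𝓝 (chartOne E G))
      (𝓝 (chartOne E G, chartOne E G)) := by
    have : Continuous fun a : E => (chartOne E G, a) := by fun_prop
    exact this.tendsto _
  filter_upwards [hc.eventually eventually_contDiffAt_chartMul,
    extChartAt_target_mem_nhds_chartOne (G := G)] with a ha hat X
  have h1 := (ha.differentiableAt (by simp)).hasFDerivAt.comp (f := fun b : E => (b, a))
    (chartOne E G) (hasFDerivAt_prodMk_left (chartOne E G) a)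
  have h2 := h1.unique (hasFDerivAt_chartMul_left hat)
  exact DFunLike.congr_fun h2 X

/-- This is dR_a ∘ Ad_a = dL_a in coordinates. It determines Ad implicitly: inverting the left-hand
operator gives regularity, and differentiating gives the bracket. -/
theorem eventually_fderiv_chartMul_modelAd :
    ∀ᶠ a in 𝓝 (chartOne E G), ∀ X : E,
      fderiv ℝ (chartMul E G) (chartOne E G, a)
        (modelAd ((extChartAt 𝓘(ℝ, E) (1 : G)).symm a) X, 0) =
      fderiv ℝ (chartMul E G) (a, chartOne E G) (0, X) := by
  filter_upwards [eventually_fderiv_chartMul_inl (G := G), eventually_fderiv_chartMul_inr (G := G)]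
    with a h1 h2 X
  rw [h1, h2]
  exact congrArg _ (mfderiv_mul_right_Ad _ X)

theorem fderiv_chartMul_inl_chartOne (X : E) :
    fderiv ℝ (chartMul E G) (chartOne E G, chartOne E G) (X, 0) = X := by
  rw [(eventually_fderiv_chartMul_inl (G := G)).self_of_nhds X, extChartAt_symm_chartOne]
  have h1 : modelDeriv (extChartAt 𝓘(ℝ, E) (1 : G)) 1 = ContinuousLinearMap.id ℝ E :=
    mfderiv_extChartAt_self (I := 𝓘(ℝ, E)) (x := (1 : G))
  have h2 : modelDeriv (fun x : G => x * 1) 1 = ContinuousLinearMap.id ℝ E := by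
    simp only [mul_one]
    exact mfderiv_id (I := 𝓘(ℝ, E)) (x := (1 : G))
  rw [h1, h2]
  rfl

theorem contDiffAt_fderiv_chartMul :
    ContDiffAt ℝ 1 (fderiv ℝ (chartMul E G)) (chartOne E G, chartOne E G) :=
  contDiffAt_chartMul.fderiv_right (m := 1) (by norm_cast)

theorem modelAd_eq_comp (g h : G) :
    modelAd (E := E) (g * h) = modelAd g ∘L modelAd h := by
  ext X
  exact Ad_mul_apply g h X

/-- Since Ad is a homomorphism, its local study at any g reduces to the chart at the identity. -/
theorem eventually_modelAd_eq (g : G) : ∀ᶠ h in 𝓝 g,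
    modelAd (E := E) h = modelAd g ∘L chartAd E G (extChartAt 𝓘(ℝ, E) (1 : G) (g⁻¹ * h)) := by
  have : IsTopologicalGroup G := topologicalGroup_of_lieGroup 𝓘(ℝ, E) ∞
  have hc : Tendsto (fun h : G => g⁻¹ * h) (𝓝 g) (𝓝 1) := by
    have : Continuous fun h : G => g⁻¹ * h := by fun_prop
    simpa using this.tendsto g
  filter_upwards [hc.eventually (extChartAt_source_mem_nhds (I := 𝓘(ℝ, E)) (1 : G))] with h hh
  rw [chartAd, (extChartAt 𝓘(ℝ, E) (1 : G)).left_inv hh, ← modelAd_eq_comp, mul_inv_cancel_left]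

variable [CompleteSpace E]

/-- Near the identity Ad_a = R(a)⁻¹ L(a), where R and L are partial derivatives of the product. R is
the identity map at the base point, so inversion is smooth there. -/
theorem contDiffAt_chartAd : ContDiffAt ℝ 1 (chartAd E G) (chartOne E G) := by
  set R : E → E →L[ℝ] E := fun a =>
    (fderiv ℝ (chartMul E G) (chartOne E G, a)).comp (ContinuousLinearMap.inl ℝ E E) with hR
  set L : E → E →L[ℝ] E := fun a =>
    (fderiv ℝ (chartMul E G) (a, chartOne E G)).comp (ContinuousLinearMap.inr ℝ E E) with hL
  have hRd : ContDiffAt ℝ 1 R (chartOne E G) := by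
    have h := ContDiffAt.comp (chartOne E G) (f := fun a : E => (chartOne E G, a))
      contDiffAt_fderiv_chartMul (by fun_prop)
    exact h.clm_comp contDiffAt_const
  have hLd : ContDiffAt ℝ 1 L (chartOne E G) := by
    have h := ContDiffAt.comp (chartOne E G) (f := fun a : E => (a, chartOne E G))
      contDiffAt_fderiv_chartMul (by fun_prop)
    exact h.clm_comp contDiffAt_const
  have hR1 : R (chartOne E G) = ContinuousLinearEquiv.refl ℝ E := by
    ext X
    exact fderiv_chartMul_inl_chartOne X
  have hinv : ContDiffAt ℝ 1 (fun a => (R a).inverse) (chartOne E G) := by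
    refine ContDiffAt.comp (chartOne E G) (g := ContinuousLinearMap.inverse) ?_ hRd
    rw [hR1]
    exact contDiffAt_map_inverse _
  have hmem : ∀ᶠ a in 𝓝 (chartOne E G), R a ∈ range ((↑) : (E ≃L[ℝ] E) → E →L[ℝ] E) := by
    refine hRd.continuousAt.eventually ?_
    rw [hR1]
    exact ContinuousLinearEquiv.nhds _
  refine (hinv.clm_comp hLd).congr_of_eventuallyEq ?_
  filter_upwards [hmem, eventually_fderiv_chartMul_modelAd (G := G)] with a ⟨e, he⟩ ha
  ext X
  have : R a (chartAd E G a X) = L a X := ha X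
  rw [ContinuousLinearMap.comp_apply, ← this, ← he]
  simp

/-- The derivative of the adjoint representation at the identity, in terms of the second derivative
of the product. -/
theorem fderiv_chartAd_apply (X Y : E) :
    fderiv ℝ (chartAd E G) (chartOne E G) X Y =
      fderiv ℝ (fun a => fderiv ℝ (chartMul E G) (a, chartOne E G) (0, Y)) (chartOne E G) X -
      fderiv ℝ (fun a => fderiv ℝ (chartMul E G) (a, chartOne E G) (0, X)) (chartOne E G) Y := by
  set x₀ := chartOne E G with hx₀
  set D := fderiv ℝ (chartMul E G) with hD
  set D2 := fderiv ℝ D (x₀, x₀) with hD2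
  have hDd : HasFDerivAt D D2 (x₀, x₀) :=
    ((contDiffAt_fderiv_chartMul (E := E) (G := G)).differentiableAt (by simp)).hasFDerivAt
  have hL : ∀ X : E, HasFDerivAt (fun a => D (a, x₀) (0, X))
      ((ContinuousLinearMap.apply ℝ E ((0 : E), X)) ∘L D2 ∘L ContinuousLinearMap.inl ℝ E E) x₀ := by
    intro X
    exact (ContinuousLinearMap.apply ℝ E ((0 : E), X)).hasFDerivAt.comp x₀
      (hDd.comp (f := fun b : E => (b, x₀)) x₀ (hasFDerivAt_prodMk_left x₀ x₀))
  have hA : HasFDerivAt (chartAd E G) (fderiv ℝ (chartAd E G) x₀) x₀ :=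
    (contDiffAt_chartAd.differentiableAt (by simp)).hasFDerivAt
  have hAY : HasFDerivAt (fun a => ((chartAd E G a Y, 0) : E × E))
      ((ContinuousLinearMap.inl ℝ E E) ∘L (ContinuousLinearMap.apply ℝ E Y) ∘L
        fderiv ℝ (chartAd E G) x₀) x₀ :=
    (ContinuousLinearMap.inl ℝ E E).hasFDerivAt.comp x₀
      ((ContinuousLinearMap.apply ℝ E Y).hasFDerivAt.comp x₀ hA)
  have hR : HasFDerivAt (fun a => D (x₀, a)) (D2 ∘L ContinuousLinearMap.inr ℝ E E) x₀ :=
    hDd.comp x₀ (hasFDerivAt_prodMk_right x₀ x₀)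
  have hprod := hR.clm_apply hAY
  have heq : (fun a => D (x₀, a) (chartAd E G a Y, 0)) =ᶠ[𝓝 x₀] fun a => D (a, x₀) (0, Y) := by
    filter_upwards [eventually_fderiv_chartMul_modelAd (G := G)] with a ha using ha Y
  -- Differentiating R(a)(Ad_a Y) = L(a) Y at the base point gives two expressions for one
  -- derivative.
  have huniq := (hprod.congr_of_eventuallyEq heq.symm).unique (hL Y)
  have h1 : chartAd E G x₀ Y = Y := by
    have : chartAd E G x₀ = ContinuousLinearMap.id ℝ E := by
      rw [chartAd, extChartAt_symm_chartOne]
      exact Ad_one (E := E) (G := G)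
    rw [this]; rfl
  have hsymm : IsSymmSndFDerivAt ℝ (chartMul E G) (x₀, x₀) :=
    contDiffAt_chartMul.isSymmSndFDerivAt (by simp; norm_cast)
  have h2 := DFunLike.congr_fun huniq X
  simp only [add_apply, ContinuousLinearMap.comp_apply,
    ContinuousLinearMap.flip_apply, ContinuousLinearMap.inl_apply, ContinuousLinearMap.inr_apply,
    ContinuousLinearMap.apply_apply, h1] at h2
  rw [(hL Y).fderiv, (hL X).fderiv]
  simp only [ContinuousLinearMap.comp_apply, ContinuousLinearMap.inl_apply,
    ContinuousLinearMap.apply_apply]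
  rw [← h2, hsymm.eq (Y, 0) (0, X), fderiv_chartMul_inl_chartOne]
  abel

/-- The Lie bracket is the derivative of the adjoint representation at the identity. -/
theorem fderiv_chartAd_eq_bracket (X Y : E) :
    fderiv ℝ (chartAd E G) (chartOne E G) X Y = modelBracket E G X Y := by
  rw [fderiv_chartAd_apply]
  -- In the chart, the left invariant field of X is the partial derivative of the product in its
  -- second variable, applied to X. The two terms found above therefore form the Lie bracket of
  -- vector fields.
  have hfield : ∀ X : E, (fun a => fderiv ℝ (chartMul E G) (a, chartOne E G) (0, X))
      =ᶠ[𝓝 (chartOne E G)]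
      VectorField.mpullbackWithin 𝓘(ℝ, E) 𝓘(ℝ, E) (extChartAt 𝓘(ℝ, E) (1 : G)).symm
        (mulInvariantVectorField (I := 𝓘(ℝ, E)) (G := G) X) (range 𝓘(ℝ, E)) := by
    intro X
    filter_upwards [eventually_fderiv_chartMul_inr (G := G),
      extChartAt_target_mem_nhds_chartOne (G := G)] with a ha hat
    rw [ha X, VectorField.mpullbackWithin_apply]
    symm
    refine ((isInvertible_mfderivWithin_extChartAt_symm hat).inverse_apply_eq).2 ?_
    have := DFunLike.congr_fun (mfderivWithin_extChartAt_symm_comp_mfderiv_extChartAt hat)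
      (mulInvariantVectorField (I := 𝓘(ℝ, E)) (G := G) X ((extChartAt 𝓘(ℝ, E) (1 : G)).symm a))
    exact this.symm
  have h1 := (hfield X).lieBracket_vectorField_eq (𝕜 := ℝ) (hfield Y)
  have hval : ∀ X : E, fderiv ℝ (chartMul E G) (chartOne E G, chartOne E G) (0, X) = X := by
    intro X
    have := (eventually_fderiv_chartMul_modelAd (G := G)).self_of_nhds X
    rw [extChartAt_symm_chartOne] at this
    rw [← this, fderiv_chartMul_inl_chartOne]
    exact DFunLike.congr_fun (Ad_one (E := E) (G := G)) X
  have h2 : VectorField.mlieBracket 𝓘(ℝ, E) (mulInvariantVectorField (I := 𝓘(ℝ, E)) (G := G) X)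
      (mulInvariantVectorField Y) 1 = VectorField.lieBracket ℝ
        (VectorField.mpullbackWithin 𝓘(ℝ, E) 𝓘(ℝ, E) (extChartAt 𝓘(ℝ, E) (1 : G)).symm
        (mulInvariantVectorField (I := 𝓘(ℝ, E)) (G := G) X) (range 𝓘(ℝ, E)))
        (VectorField.mpullbackWithin 𝓘(ℝ, E) 𝓘(ℝ, E) (extChartAt 𝓘(ℝ, E) (1 : G)).symm
        (mulInvariantVectorField (I := 𝓘(ℝ, E)) (G := G) Y) (range 𝓘(ℝ, E))) (chartOne E G) := by
    rw [← VectorField.mlieBracketWithin_univ, VectorField.mlieBracketWithin_apply,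
      mfderiv_extChartAt_self, preimage_univ, univ_inter]
    refine (DFunLike.congr_fun (ContinuousLinearMap.inverse_id (R := ℝ) (M := E)) _).trans ?_
    rw [modelWithCornersSelf_coe, range_id]
    exact congrFun VectorField.lieBracketWithin_univ _
  refine Eq.trans ?_ (h1.trans h2.symm)
  simp only [VectorField.lieBracket, hval]

theorem contMDiff_modelAd :
    ContMDiff 𝓘(ℝ, E) 𝓘(ℝ, E →L[ℝ] E) 1 (modelAd : G → E →L[ℝ] E) := by
  intro g
  refine ContMDiffAt.congr_of_eventuallyEq ?_ (eventually_modelAd_eq g)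
  have h1 : ContMDiffAt 𝓘(ℝ, E) 𝓘(ℝ, E) 1
      (fun h : G => extChartAt 𝓘(ℝ, E) (1 : G) (g⁻¹ * h)) g := by
    refine ContMDiffAt.comp g (g := extChartAt 𝓘(ℝ, E) (1 : G)) ?_
      ((contMDiff_mul_left (I := 𝓘(ℝ, E)) (n := ∞)).of_le (by norm_cast)).contMDiffAt
    simp only [inv_mul_cancel]
    exact contMDiffAt_extChartAt
  have h2 : ContDiffAt ℝ 1 (fun a => modelAd g ∘L chartAd E G a)
      (extChartAt 𝓘(ℝ, E) (1 : G) (g⁻¹ * g)) := by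
    rw [inv_mul_cancel]
    exact contDiffAt_const.clm_comp contDiffAt_chartAd
  exact ContMDiffAt.comp g (contMDiffAt_iff_contDiffAt.2 h2) h1

/-- The derivative of the adjoint representation along a curve with velocity `dL_γ X`. -/
theorem hasDerivAt_modelAd {γ : ℝ → G} {t : ℝ} {X : GroupLieAlgebra 𝓘(ℝ, E) G}
    (hγ : HasMFDerivAt 𝓘(ℝ, ℝ) 𝓘(ℝ, E) γ t
      ((1 : ℝ →L[ℝ] ℝ).smulRight (mulInvariantVectorField X (γ t)))) :
    HasDerivAt (fun s => modelAd (γ s))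
      (modelAd (γ t) ∘L fderiv ℝ (chartAd E G) (chartOne E G) X) t := by
  set g := γ t with hg
  have h1 : HasMFDerivAt 𝓘(ℝ, E) 𝓘(ℝ, E) (fun h : G => g⁻¹ * h) g
      (modelDeriv (E := E) (fun h : G => g⁻¹ * h) g) :=
    (mdifferentiableAt_leftMul g⁻¹ g).hasMFDerivAt
  have h2 : HasMFDerivAt 𝓘(ℝ, E) 𝓘(ℝ, E) (extChartAt 𝓘(ℝ, E) (1 : G)) (g⁻¹ * g)
      (ContinuousLinearMap.id ℝ E) := by
    rw [inv_mul_cancel]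
    have := (mdifferentiableAt_extChartAt (I := 𝓘(ℝ, E)) (mem_chart_source E (1 : G))).hasMFDerivAt
    rwa [mfderiv_extChartAt_self] at this
  have h3 : HasFDerivAt (fun s => extChartAt 𝓘(ℝ, E) (1 : G) (g⁻¹ * γ s))
      ((ContinuousLinearMap.id ℝ E) ∘L (modelDeriv (E := E) (fun h : G => g⁻¹ * h) g) ∘L
        ((1 : ℝ →L[ℝ] ℝ).smulRight (modelDeriv (fun x : G => g * x) 1 X))) t :=
    HasMFDerivAt.hasFDerivAt (HasMFDerivAt.comp t (f := fun s => g⁻¹ * γ s) h2 (h1.comp t hγ))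
  -- Translating the curve back to the identity turns the velocity dL_g X into X.
  have h4 : modelDeriv (E := E) (fun h : G => g⁻¹ * h) g (modelDeriv (fun x : G => g * x) 1 X) =
      X := by
    have hid : (fun h : G => g⁻¹ * h) ∘ (fun x : G => g * x) = id := by ext x; simp
    have key := mfderiv_comp_apply_of_eq (x := (1 : G)) (y := g)
      (mdifferentiableAt_leftMul (E := E) g⁻¹ g) (mdifferentiableAt_leftMul (E := E) g 1)
      (by simp) X
    rw [hid, mfderiv_id] at key
    exact key.symm
  have h5 := h3.hasDerivAt
  simp only [ContinuousLinearMap.comp_apply, ContinuousLinearMap.smulRight_apply,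
    one_apply_eq_self, one_smul, h4] at h5
  have h6 : HasFDerivAt (chartAd E G) (fderiv ℝ (chartAd E G) (chartOne E G))
      (extChartAt 𝓘(ℝ, E) (1 : G) (g⁻¹ * γ t)) := by
    rw [← hg, inv_mul_cancel]
    exact (contDiffAt_chartAd.differentiableAt (by simp)).hasFDerivAt
  have h7 := (ContinuousLinearMap.compL ℝ E E E (modelAd g)).hasFDerivAt.comp_hasDerivAt t
    (h6.comp_hasDerivAt t h5)
  refine h7.congr_of_eventuallyEq ?_
  filter_upwards [hγ.continuousAt.eventually (eventually_modelAd_eq (E := E) g)] with s hs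
  rw [hs]
  rfl

end AdjointRepresentation

/-! ### Absolutely continuous functions on an interval. -/

section AbsoluteContinuity

open Filter Topology
open scoped NNReal

/-- A function whose increments are controlled by those of an absolutely continuous function is
absolutely continuous. -/
theorem AbsolutelyContinuousOnInterval.of_dist_le {X Y : Type*} [PseudoMetricSpace X]
    [PseudoMetricSpace Y] {f : ℝ → X} {g : ℝ → Y} {a b K : ℝ}
    (hf : AbsolutelyContinuousOnInterval f a b)
    (h : ∀ x ∈ uIcc a b, ∀ y ∈ uIcc a b, dist (g x) (g y) ≤ K * dist (f x) (f y)) :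
    AbsolutelyContinuousOnInterval g a b := by
  have hK : Tendsto (fun e : ℕ × (ℕ → ℝ × ℝ) =>
      K * ∑ i ∈ Finset.range e.1, dist (f (e.2 i).1) (f (e.2 i).2))
      (AbsolutelyContinuousOnInterval.totalLengthFilter ⊓
        𝓟 (AbsolutelyContinuousOnInterval.disjWithin a b)) (𝓝 0) := by
    simpa only [mul_zero] using Filter.Tendsto.const_mul K hf
  refine squeeze_zero' (.of_forall fun e => Finset.sum_nonneg fun i _ => dist_nonneg) ?_ hK
  have hmem : ∀ᶠ e in AbsolutelyContinuousOnInterval.totalLengthFilter (X := ℝ) ⊓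
      𝓟 (AbsolutelyContinuousOnInterval.disjWithin a b),
      e ∈ AbsolutelyContinuousOnInterval.disjWithin a b :=
    mem_inf_of_right (mem_principal_self _)
  filter_upwards [hmem] with e he
  rw [Finset.mul_sum]
  exact Finset.sum_le_sum fun i hi => h _ (he.1 i hi).1 _ (he.1 i hi).2

/-- Monotonicity keeps disjoint intervals disjoint, and the Lipschitz bound controls their total
length. -/
theorem AbsolutelyContinuousOnInterval.comp_monotone {X : Type*} [PseudoMetricSpace X]
    {f : ℝ → X} {φ : ℝ → ℝ} {a b c d : ℝ} {K : ℝ≥0} (hf : AbsolutelyContinuousOnInterval f a b)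
    (hm : Monotone φ) (hφ : LipschitzWith K φ) (hmap : MapsTo φ (uIcc c d) (uIcc a b)) :
    AbsolutelyContinuousOnInterval (fun x => f (φ x)) c d := by
  rw [absolutelyContinuousOnInterval_iff] at hf ⊢
  intro ε hε
  obtain ⟨δ, hδ, h⟩ := hf ε hε
  refine ⟨δ / (K + 1), by positivity, fun e he hlt => ?_⟩
  refine h (e.1, fun i => (φ (e.2 i).1, φ (e.2 i).2)) ⟨?_, ?_⟩ ?_
  · exact fun i hi => ⟨hmap (he.1 i hi).1, hmap (he.1 i hi).2⟩
  · intro i hi j hj hij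
    have hdis := he.2 hi hj hij
    simp only [Function.onFun, uIoc, Ioc_disjoint_Ioc, ← hm.map_max, ← hm.map_min] at hdis ⊢
    exact hm hdis
  · calc ∑ i ∈ Finset.range e.1, dist (φ (e.2 i).1) (φ (e.2 i).2)
        ≤ ∑ i ∈ Finset.range e.1, (K + 1 : ℝ) * dist (e.2 i).1 (e.2 i).2 := by
          refine Finset.sum_le_sum fun i _ => (hφ.dist_le_mul _ _).trans ?_
          gcongr
          simp
      _ = (K + 1 : ℝ) * ∑ i ∈ Finset.range e.1, dist (e.2 i).1 (e.2 i).2 := by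
          rw [Finset.mul_sum]
      _ < δ := by
          rw [lt_div_iff₀ (by positivity)] at hlt
          linarith

variable {F : Type*} [NormedAddCommGroup F]

/-- Up to the constant f(b), f is the sum of f(min(·, b)) and f(max(·, b)), each frozen on one side
of b. -/
theorem AbsolutelyContinuousOnInterval.trans {f : ℝ → F} {a b c : ℝ} (hab : a ≤ b) (hbc : b ≤ c)
    (h₁ : AbsolutelyContinuousOnInterval f a b) (h₂ : AbsolutelyContinuousOnInterval f b c) :
    AbsolutelyContinuousOnInterval f a c := by
  have e₁ : AbsolutelyContinuousOnInterval (fun x => f (min x b)) a c := by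
    refine h₁.comp_monotone (K := 1) (monotone_id.min monotone_const)
      (LipschitzWith.id.min_const b) fun x hx => ?_
    rw [uIcc_of_le (hab.trans hbc)] at hx
    rw [uIcc_of_le hab]
    exact ⟨le_min hx.1 hab, min_le_right _ _⟩
  have e₂ : AbsolutelyContinuousOnInterval (fun x => f (max x b)) a c := by
    refine h₂.comp_monotone (K := 1) (monotone_id.max monotone_const)
      (LipschitzWith.id.max_const b) fun x hx => ?_
    rw [uIcc_of_le (hab.trans hbc)] at hx
    rw [uIcc_of_le hbc]
    exact ⟨le_max_right _ _, max_le hx.2 hbc⟩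
  refine (e₁.add e₂).of_dist_le (K := 1) fun x _ y _ => ?_
  have key : ∀ z, f z = f (min z b) + f (max z b) - f b := by
    intro z
    rcases le_total z b with h | h <;> simp [h]
  rw [key x, key y]
  simp

/-- Absolute continuity is a local property. -/
theorem AbsolutelyContinuousOnInterval.of_local {f : ℝ → F} {a b : ℝ} (hab : a ≤ b)
    (h : ∀ t ∈ Icc a b, ∃ ε > 0, ∀ c d, c ≤ d → Icc c d ⊆ Icc a b → Icc c d ⊆ Metric.ball t ε →
      AbsolutelyContinuousOnInterval f c d) :
    AbsolutelyContinuousOnInterval f a b := by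
  choose! ε hε hac using h
  obtain ⟨δ, hδ, hleb⟩ := lebesgue_number_lemma_of_metric (isCompact_Icc (a := a) (b := b))
    (c := fun t : Icc a b => Metric.ball (t : ℝ) (ε t)) (fun t => Metric.isOpen_ball)
    (fun t ht => mem_iUnion.2 ⟨⟨t, ht⟩, Metric.mem_ball_self (hε t ht)⟩)
  have hsmall : ∀ c d, a ≤ c → c ≤ d → d ≤ b → d < c + δ →
      AbsolutelyContinuousOnInterval f c d := by
    intro c d hac' hcd hdb hlt
    obtain ⟨⟨t, ht⟩, hsub⟩ := hleb c ⟨hac', hcd.trans hdb⟩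
    refine hac t ht c d hcd (Icc_subset_Icc hac' hdb) (Subset.trans (fun x hx => ?_) hsub)
    rw [Metric.mem_ball, Real.dist_eq, abs_lt]
    constructor <;> linarith [hx.1, hx.2]
  -- Advance by half a Lebesgue number at a time, stopping at b.
  have hstep : ∀ n : ℕ, AbsolutelyContinuousOnInterval f a (min b (a + n * (δ / 2))) := by
    intro n
    induction n with
    | zero => exact hsmall a _ le_rfl (by simp [hab]) (min_le_left _ _) (by simp [hab, hδ])
    | succ n ih =>
      have h0 : a ≤ a + n * (δ / 2) := by
        have : 0 ≤ n * (δ / 2) := by positivity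
        linarith
      have h1 : a + n * (δ / 2) ≤ a + ((n + 1 : ℕ) : ℝ) * (δ / 2) := by
        push_cast; linarith
      refine ih.trans (le_min hab h0) (min_le_min_left b h1)
        (hsmall _ _ (le_min hab h0) (min_le_min_left b h1) (min_le_left _ _) ?_)
      rcases le_total b (a + n * (δ / 2)) with hb | hb
      · rw [min_eq_left hb, min_eq_left (hb.trans h1)]
        linarith
      · rw [min_eq_right hb]
        refine (min_le_right _ _).trans_lt ?_
        push_cast; linarith
  obtain ⟨n, hn⟩ := exists_nat_gt ((b - a) / (δ / 2))
  rw [div_lt_iff₀ (by positivity)] at hn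
  have := hstep n
  rwa [min_eq_left (by linarith)] at this

theorem AbsolutelyContinuousOnInterval.abs_sub_le {f f' : ℝ → ℝ} {a b C : ℝ} (hab : a ≤ b)
    (hf : AbsolutelyContinuousOnInterval f a b)
    (hd : ∀ᵐ t ∂volume.restrict (Icc a b), HasDerivAt f (f' t) t ∧ |f' t| ≤ C) :
    |f b - f a| ≤ C * (b - a) := by
  rw [← hf.integral_deriv_eq_sub, ← abs_of_nonneg (sub_nonneg.2 hab), ← Real.norm_eq_abs]
  refine intervalIntegral.norm_integral_le_of_norm_le_const_ae ?_
  rw [ae_restrict_iff' measurableSet_Icc] at hd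
  filter_upwards [hd] with t ht hmem
  rw [uIoc_of_le hab] at hmem
  obtain ⟨h1, h2⟩ := ht (Ioc_subset_Icc_self hmem)
  rwa [h1.deriv]

/-- An upper bound on the derivative suffices because the negative part of its integral can be
dropped. The lower integral on the right matches the form of the length of a curve. -/
theorem AbsolutelyContinuousOnInterval.sub_le_lintegral {f f' g : ℝ → ℝ} {a b : ℝ} (hab : a ≤ b)
    (hf : AbsolutelyContinuousOnInterval f a b)
    (hd : ∀ᵐ t ∂volume.restrict (Icc a b), HasDerivAt f (f' t) t ∧ f' t ≤ g t)
    (hg : ∫⁻ t in Icc a b, ENNReal.ofReal (g t) ≠ ⊤) :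
    f b - f a ≤ (∫⁻ t in Icc a b, ENNReal.ofReal (g t)).toReal := by
  rw [← hf.integral_deriv_eq_sub, intervalIntegral.integral_of_le hab,
    ← integral_Icc_eq_integral_Ioc]
  have hint : Integrable (deriv f) (volume.restrict (Icc a b)) := by
    have := hf.intervalIntegrable_deriv
    rw [intervalIntegrable_iff_integrableOn_Ioc_of_le hab,
      ← integrableOn_Icc_iff_integrableOn_Ioc] at this
    exact this
  rw [integral_eq_lintegral_pos_part_sub_lintegral_neg_part hint]
  refine (sub_le_self _ ENNReal.toReal_nonneg).trans (ENNReal.toReal_mono hg ?_)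
  refine lintegral_mono_ae ?_
  filter_upwards [hd] with t ht
  rw [ht.1.deriv]
  exact ENNReal.ofReal_le_ofReal ht.2

end AbsoluteContinuity

/-! ### Polyhedral norms, their dual norms and their faces. -/

section PolyhedralNorm

variable {W : Type*} [AddCommGroup W] [Module ℝ W] {p : Seminorm ℝ W} {s : Finset W}

/-- The subgradients of the energy at `u` have dual norm `p u`, and attain it at `u`. -/
theorem apply_eq_and_le_of_mem_subdifferential_energy {η : Module.Dual ℝ W} {u : W}
    (h : η ∈ subdifferential (energy p) u) :
    η u = p u ^ 2 ∧ ∀ w, p w ≤ 1 → η w ≤ p u := by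
  -- Test the subgradient inequality on multiples of u; small x of either sign will give η u = p u ^
  -- 2.
  have hs : ∀ x : ℝ, x * η u ≤ (x + x ^ 2 / 2) * p u ^ 2 := by
    intro x
    have h1 := h ((1 + x) • u)
    rw [energy, energy, map_smul_eq_mul, mul_pow, Real.norm_eq_abs, sq_abs, map_sub, map_smul,
      smul_eq_mul] at h1
    nlinarith
  have hw : ∀ w, p w ≤ 1 → ∀ x : ℝ, 0 < x → η w ≤ p u + x / 2 := by
    intro w hw x hx
    have h1 := h (u + x • w)
    have h2 : p (u + x • w) ≤ p u + x := by
      refine (map_add_le_add p _ _).trans ?_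
      rw [map_smul_eq_mul, Real.norm_eq_abs, abs_of_pos hx]
      nlinarith
    have h3 : p (u + x • w) ^ 2 ≤ (p u + x) ^ 2 := pow_le_pow_left₀ (apply_nonneg p _) h2 2
    rw [energy, energy, add_sub_cancel_left, map_smul, smul_eq_mul] at h1
    refine le_of_mul_le_mul_left ?_ hx
    nlinarith
  constructor
  · refine le_antisymm ?_ ?_
    · refine le_of_forall_pos_le_add fun ε hε => ?_
      have hpos : 0 < ε / (p u ^ 2 + 1) := by positivity
      have h1 := hs (ε / (p u ^ 2 + 1))
      have h2 : ε / (p u ^ 2 + 1) * p u ^ 2 ≤ ε := by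
        rw [div_mul_eq_mul_div, div_le_iff₀ (by positivity)]
        nlinarith
      refine le_of_mul_le_mul_left ?_ hpos
      nlinarith
    · refine le_of_forall_pos_le_add fun ε hε => ?_
      have hpos : 0 < ε / (p u ^ 2 + 1) := by positivity
      have h1 := hs (-(ε / (p u ^ 2 + 1)))
      have h2 : ε / (p u ^ 2 + 1) * p u ^ 2 ≤ ε := by
        rw [div_mul_eq_mul_div, div_le_iff₀ (by positivity)]
        nlinarith
      refine le_of_mul_le_mul_left ?_ hpos
      nlinarith
  · intro w hpw
    refine le_of_forall_pos_le_add fun ε hε => ?_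
    have := hw w hpw (2 * ε) (by positivity)
    linarith

theorem le_of_mem_convexHull {η : Module.Dual ℝ W} {S : Set W} {c : ℝ} (hη : ∀ v ∈ S, η v ≤ c)
    {w : W} (hw : w ∈ convexHull ℝ S) : η w ≤ c :=
  convexHull_min hη (convex_halfSpace_le η.isLinear c) hw

theorem le_of_le_one (hs : {v | p v ≤ 1} = convexHull ℝ (s : Set W)) {η : Module.Dual ℝ W} {c : ℝ}
    (hη : ∀ v ∈ s, η v ≤ c) {w : W} (hw : p w ≤ 1) : η w ≤ c :=
  le_of_mem_convexHull hη (hs ▸ hw : w ∈ convexHull ℝ (s : Set W))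

theorem seminorm_le_one_of_mem (hs : {v | p v ≤ 1} = convexHull ℝ (s : Set W)) {v : W}
    (hv : v ∈ s) : p v ≤ 1 := by
  have : v ∈ {v | p v ≤ 1} := hs ▸ subset_convexHull ℝ _ hv
  exact this

theorem nonempty_of_ball_eq (hs : {v | p v ≤ 1} = convexHull ℝ (s : Set W)) : s.Nonempty := by
  have : (0 : W) ∈ {v | p v ≤ 1} := by simp
  rw [hs] at this
  exact_mod_cast convexHull_nonempty_iff.1 ⟨0, this⟩

theorem abs_apply_le_of_forall_le (hs : {v | p v ≤ 1} = convexHull ℝ (s : Set W))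
    {η : Module.Dual ℝ W} {c : ℝ} (hη : ∀ v ∈ s, η v ≤ c) {v : W} (hv : v ∈ s) : |η v| ≤ c := by
  refine abs_le.2 ⟨?_, hη v hv⟩
  have h1 : η (-v) ≤ c := le_of_le_one hs hη (by
    rw [map_neg_eq_map]; exact seminorm_le_one_of_mem hs hv)
  rw [map_neg] at h1
  linarith

/-- If `S` does not lie on one face of the unit sphere, then no functional of dual norm one is
close to `1` at all points of `S`. -/
theorem exists_pos_forall_exists_eq_one (hs : {v | p v ≤ 1} = convexHull ℝ (s : Set W))
    (S : Finset W) (hS : S ⊆ s) :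
    ∃ δ > 0, ∀ η : Module.Dual ℝ W, (∀ v ∈ s, η v ≤ 1) → (∃ v ∈ s, η v = 1) →
      (∀ v ∈ S, 1 - δ ≤ η v) →
      ∃ ξ : Module.Dual ℝ W, (∀ v ∈ s, ξ v ≤ 1) ∧ (∃ v ∈ s, ξ v = 1) ∧ ∀ v ∈ S, ξ v = 1 := by
  classical
  let ev : Module.Dual ℝ W →ₗ[ℝ] (s → ℝ) := LinearMap.pi fun v => Module.Dual.eval ℝ W v
  have hev : ∀ (ξ : Module.Dual ℝ W) (v : s), ev ξ v = ξ v := fun ξ v => rfl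
  -- Functionals of dual norm one, recorded by their values on s: these form a compact set in a
  -- finite-dimensional space.
  let K : Set (s → ℝ) := Icc (-1) 1 ∩ ((LinearMap.range ev : Set (s → ℝ)) ∩ {x | ∃ v, x v = 1})
  have hK : IsCompact K := by
    refine isCompact_Icc.inter_right (IsClosed.inter
      (Submodule.closed_of_finiteDimensional (LinearMap.range ev)) ?_)
    rw [ofPred_exists]
    exact isClosed_iUnion_of_finite fun v => isClosed_eq (continuous_apply v) continuous_const
  have hmemK : ∀ η : Module.Dual ℝ W, (∀ v ∈ s, η v ≤ 1) → (∃ v ∈ s, η v = 1) → ev η ∈ K := by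
    rintro η h1 ⟨v, hv, hv1⟩
    refine ⟨⟨fun v => ?_, fun v => h1 v v.2⟩, ⟨η, rfl⟩, ⟨v, hv⟩, hv1⟩
    exact (abs_le.1 (abs_apply_le_of_forall_le hs h1 v.2)).1
  by_cases hex : ∃ ξ : Module.Dual ℝ W, (∀ v ∈ s, ξ v ≤ 1) ∧ (∃ v ∈ s, ξ v = 1) ∧ ∀ v ∈ S, ξ v = 1
  · exact ⟨1, one_pos, fun _ _ _ _ => hex⟩
  -- The total defect from maximality on S. If no functional is maximal on all of S, it is positive
  -- on K and so has a positive lower bound m.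
  let f : (s → ℝ) → ℝ := fun x => ∑ v ∈ s.attach with v.1 ∈ S, (1 - x v)
  have hf : Continuous f := by fun_prop
  have hpos : ∀ x ∈ K, 0 < f x := by
    rintro _ ⟨⟨hx1, hx2⟩, ⟨ξ, rfl⟩, ⟨v, hv⟩⟩
    have hnn : ∀ v ∈ s.attach.filter (fun v => v.1 ∈ S), 0 ≤ 1 - ev ξ v :=
      fun v _ => sub_nonneg.2 (hx2 v)
    refine (Finset.sum_nonneg hnn).lt_of_ne fun h0 => hex ?_
    refine ⟨ξ, fun v hv => hx2 ⟨v, hv⟩, ⟨v, v.2, hv⟩, fun w hw => ?_⟩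
    have := (Finset.sum_eq_zero_iff_of_nonneg hnn).1 h0.symm ⟨w, hS hw⟩ (by simpa using hw)
    rw [hev] at this
    linarith
  obtain ⟨m, hm, hmle⟩ := hK.exists_forall_le' hf.continuousOn hpos
  refine ⟨m / (s.card + 1), by positivity, fun η h1 h2 h3 => ?_⟩
  exfalso
  have h4 := hmle _ (hmemK η h1 h2)
  have h5 : f (ev η) ≤ s.card * (m / (s.card + 1)) := by
    calc f (ev η) ≤ ∑ v ∈ s.attach with v.1 ∈ S, m / (s.card + 1) := by
          refine Finset.sum_le_sum fun v hv => ?_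
          have := h3 v (Finset.mem_filter.1 hv).2
          rw [hev]
          linarith
      _ ≤ ∑ v ∈ s.attach, m / (s.card + 1) :=
          Finset.sum_le_sum_of_subset_of_nonneg (Finset.filter_subset _ _)
            fun _ _ _ => by positivity
      _ = s.card * (m / (s.card + 1)) := by simp
  have h6 : s.card * (m / (s.card + 1)) < m := by
    rw [← mul_div_assoc, div_lt_iff₀ (by positivity)]
    nlinarith
  linarith

theorem exists_pos_forall_subset_exists_eq_one (hs : {v | p v ≤ 1} = convexHull ℝ (s : Set W)) :
    ∃ δ > 0, ∀ S ⊆ s, ∀ η : Module.Dual ℝ W, (∀ v ∈ s, η v ≤ 1) → (∃ v ∈ s, η v = 1) →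
      (∀ v ∈ S, 1 - δ ≤ η v) →
      ∃ ξ : Module.Dual ℝ W, (∀ v ∈ s, ξ v ≤ 1) ∧ (∃ v ∈ s, ξ v = 1) ∧ ∀ v ∈ S, ξ v = 1 := by
  choose! δ hδ h using exists_pos_forall_exists_eq_one hs
  have hne : s.powerset.Nonempty := ⟨∅, by simp⟩
  refine ⟨s.powerset.inf' hne δ, ?_, fun S hS η h1 h2 h3 => h S hS η h1 h2 fun v hv => ?_⟩
  · exact (Finset.lt_inf'_iff hne).2 fun S hS => hδ S (Finset.mem_powerset.1 hS)
  · have := Finset.inf'_le δ (Finset.mem_powerset.2 hS)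
    linarith [h3 v hv]

/-- A functional that is maximal at the vertices where `η` is maximal is maximal at the points of
the unit ball where `η` is maximal. -/
theorem apply_eq_one_of_apply_eq (hs : {v | p v ≤ 1} = convexHull ℝ (s : Set W))
    {η ξ : Module.Dual ℝ W} {r : ℝ} (hη : ∀ v ∈ s, η v ≤ r)
    (hξ : ∀ v ∈ s, η v = r → ξ v = 1) {w : W} (hw : p w ≤ 1) (hwr : η w = r) : ξ w = 1 := by
  have hw' : w ∈ convexHull ℝ (s : Set W) := hs ▸ hw
  obtain ⟨c, hc0, hc1, hcw⟩ := Finset.mem_convexHull'.1 hw'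
  -- A convex combination attains the maximum of η only if every vertex of positive weight does.
  have hsum : ∑ v ∈ s, c v * (r - η v) = 0 := by
    have h1 : η w = ∑ v ∈ s, c v * η v := by rw [← hcw]; simp
    simp only [mul_sub, Finset.sum_sub_distrib, ← Finset.sum_mul, hc1]
    linarith
  have hz := (Finset.sum_eq_zero_iff_of_nonneg
    fun v hv => mul_nonneg (hc0 v hv) (sub_nonneg.2 (hη v hv))).1 hsum
  calc ξ w = ∑ v ∈ s, c v * ξ v := by rw [← hcw]; simp
    _ = ∑ v ∈ s, c v := by
      refine Finset.sum_congr rfl fun v hv => ?_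
      rcases mul_eq_zero.1 (hz v hv) with h | h
      · simp [h]
      · rw [hξ v hv (by linarith), mul_one]
    _ = 1 := hc1

/-- If the covectors `η t` of dual norm `r` vary little compared to `r` on an interval, then the
points of the sphere of radius `r` where they are maximal lie on one face. -/
theorem exists_pos_takesValueInFace (hs : {v | p v ≤ 1} = convexHull ℝ (s : Set W)) :
    ∃ δ > 0, ∀ r : ℝ, 0 < r → ∀ (u : ℝ → W) (η : ℝ → Module.Dual ℝ W) (a b : ℝ), a ≤ b →
      (∀ t ∈ Icc a b, (∀ v ∈ s, η t v ≤ r) ∧ ∃ v ∈ s, η t v = r) →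
      (∀ᵐ t ∂volume.restrict (Icc a b), p (u t) = r ∧ η t (u t) = r ^ 2) →
      (∀ v ∈ s, ∀ t ∈ Icc a b, |η t v - η a v| ≤ δ * r) → TakesValueInFace p u a b := by
  classical
  obtain ⟨δ, hδ, h⟩ := exists_pos_forall_subset_exists_eq_one hs
  refine ⟨δ, hδ, fun r hr u η a b hab hmax hu hosc => ?_⟩
  have ha : a ∈ Icc a b := ⟨le_rfl, hab⟩
  -- Take the vertices where η t is maximal for some t in the interval. Small oscillation makes η a
  -- almost maximal at all of them, so a single ξ is exactly maximal there.
  obtain ⟨ξ, hξ1, ⟨v₀, hv₀, hξv₀⟩, hξS⟩ := h (s.filter fun v => ∃ t ∈ Icc a b, η t v = r)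
    (Finset.filter_subset _ _) (r⁻¹ • η a) (fun v hv => by
      have := (hmax a ha).1 v hv
      rw [LinearMap.smul_apply, smul_eq_mul, inv_mul_le_iff₀ hr]
      linarith) (by
      obtain ⟨v, hv, hvr⟩ := (hmax a ha).2
      exact ⟨v, hv, by rw [LinearMap.smul_apply, hvr, smul_eq_mul, inv_mul_cancel₀ hr.ne']⟩)
    (fun v hv => by
      obtain ⟨hvs, t, ht, hvt⟩ := Finset.mem_filter.1 hv
      have := (abs_le.1 (hosc v hvs t ht)).2
      rw [LinearMap.smul_apply, smul_eq_mul, le_inv_mul_iff₀ hr]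
      rw [hvt] at this
      linarith)
  have hξ0 : ξ ≠ 0 := by
    rintro rfl
    simp at hξv₀
  have hball : ∀ w, p w ≤ r → ξ w ≤ r := by
    intro w hw
    have h1 : ξ (r⁻¹ • w) ≤ 1 := le_of_le_one hs hξ1 (by
      rw [map_smul_eq_mul, Real.norm_eq_abs, abs_of_pos (inv_pos.2 hr), inv_mul_le_iff₀ hr]
      linarith)
    rw [map_smul, smul_eq_mul, inv_mul_le_iff₀ hr] at h1
    linarith
  refine ⟨r, hr, _, ⟨ξ, hξ0, rfl⟩, ?_⟩
  filter_upwards [hu, ae_restrict_mem measurableSet_Icc] with t ht htm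
  have h1 : ξ (r⁻¹ • u t) = 1 := by
    refine apply_eq_one_of_apply_eq hs (hmax t htm).1
      (fun v hv hvr => hξS v (Finset.mem_filter.2 ⟨hv, t, htm, hvr⟩)) ?_ ?_
    · rw [map_smul_eq_mul, Real.norm_eq_abs, abs_of_pos (inv_pos.2 hr), ht.1,
        inv_mul_cancel₀ hr.ne']
    · rw [map_smul, smul_eq_mul, ht.2]
      field_simp
  rw [map_smul, smul_eq_mul, inv_mul_eq_iff_eq_mul₀ hr.ne'] at h1
  refine ⟨ht.1.le, fun w hw => ?_⟩
  rw [h1, mul_one]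
  exact hball w hw

theorem sup'_apply_nonneg (hs : {v | p v ≤ 1} = convexHull ℝ (s : Set W)) (hne : s.Nonempty)
    (η : Module.Dual ℝ W) : 0 ≤ s.sup' hne η := by
  have h : η 0 ≤ s.sup' hne η := le_of_le_one hs (fun v hv => Finset.le_sup' η hv) (by simp)
  rwa [map_zero] at h

/-- The maximum over s is the dual norm, attained by a subgradient at u / p u; for p u = 0
nonnegativity closes the gap. -/
theorem sup'_apply_eq_of_mem_subdifferential (hs : {v | p v ≤ 1} = convexHull ℝ (s : Set W))
    (hne : s.Nonempty) {η : Module.Dual ℝ W} {u : W}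
    (h : η ∈ subdifferential (energy p) u) : s.sup' hne η = p u := by
  obtain ⟨h1, h2⟩ := apply_eq_and_le_of_mem_subdifferential_energy h
  refine le_antisymm (Finset.sup'_le _ _ fun v hv => h2 v (seminorm_le_one_of_mem hs hv)) ?_
  rcases (apply_nonneg p u).eq_or_lt with h0 | hpos
  · rw [← h0]
    exact sup'_apply_nonneg hs hne η
  · have h3 : η ((p u)⁻¹ • u) ≤ s.sup' hne η := le_of_le_one hs
      (fun v hv => Finset.le_sup' η hv) (by
        rw [map_smul_eq_mul, Real.norm_eq_abs, abs_of_pos (inv_pos.2 hpos),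
          inv_mul_cancel₀ hpos.ne'])
    rw [map_smul, h1, smul_eq_mul, sq, inv_mul_cancel_left₀ hpos.ne'] at h3
    exact h3

/-- Conservation of the dual norm along a covector curve that is stationary in the direction of the
control. -/
theorem exists_forall_sup'_apply_eq (hs : {v | p v ≤ 1} = convexHull ℝ (s : Set W))
    (hne : s.Nonempty) {η : ℝ → Module.Dual ℝ W} {u : ℝ → W}
    (hac : AbsolutelyContinuousOnInterval (fun t => fun v : s => η t v) 0 1)
    (hinc : ∀ᵐ t ∂volume.restrict (Icc (0 : ℝ) 1), η t ∈ subdifferential (energy p) (u t))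
    (hd : ∀ᵐ t ∂volume.restrict (Icc (0 : ℝ) 1), HasDerivAt (fun τ => η τ (u t)) 0 t) :
    ∃ r, 0 ≤ r ∧ ∀ t ∈ Icc (0 : ℝ) 1, s.sup' hne (η t) = r := by
  have hacs : AbsolutelyContinuousOnInterval (fun t => s.sup' hne (η t)) 0 1 := by
    refine hac.of_dist_le (K := 1) fun x _ y _ => ?_
    have key : ∀ x y, s.sup' hne (η x) ≤ s.sup' hne (η y) +
        dist (fun v : s => η x v) (fun v : s => η y v) := by
      intro x y
      refine Finset.sup'_le _ _ fun v hv => ?_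
      have h1 := dist_le_pi_dist (fun v : s => η x v) (fun v : s => η y v) ⟨v, hv⟩
      have h2 := Finset.le_sup' (η y) hv
      rw [Real.dist_eq] at h1
      linarith [le_abs_self (η x v - η y v)]
    rw [one_mul, Real.dist_eq, abs_le]
    have h1 := key x y
    have h2 := key y x
    rw [dist_comm] at h2
    constructor <;> linarith
  have hdiff := hacs.ae_differentiableAt
  rw [uIcc_of_le zero_le_one] at hdiff
  rw [ae_restrict_iff' measurableSet_Icc] at hinc hd
  obtain ⟨r, hr⟩ := hacs.const_of_ae_hasDerivAt_zero (by
    rw [uIcc_of_le zero_le_one]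
    filter_upwards [hdiff, hinc, hd] with t h1 h2 h3 ht
    have hder := (h1 ht).hasDerivAt
    obtain ⟨hval, -⟩ := apply_eq_and_le_of_mem_subdifferential_energy (h2 ht)
    have hsup := sup'_apply_eq_of_mem_subdifferential hs hne (h2 ht)
    rcases (apply_nonneg p (u t)).eq_or_lt with h0 | hpos
    -- Where the control vanishes, so does the dual norm, which is then at its minimum.
    · have hmin : IsLocalMin (fun τ => s.sup' hne (η τ)) t := by
        refine Filter.Eventually.of_forall fun τ => ?_
        change s.sup' hne (η t) ≤ s.sup' hne (η τ)
        rw [hsup, ← h0]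
        exact sup'_apply_nonneg hs hne (η τ)
      rwa [hmin.hasDerivAt_eq_zero hder] at hder
    · have hg := hder.sub ((h3 ht).const_mul (p (u t))⁻¹)
      -- Envelope argument: the dual norm dominates evaluation at u t / p (u t), with equality at
      -- time t, so both have the same derivative there, namely zero.
      have hmin : IsLocalMin
          ((fun τ => s.sup' hne (η τ)) - fun τ => (p (u t))⁻¹ * η τ (u t)) t := by
        refine Filter.Eventually.of_forall fun τ => ?_
        have h4 : η τ ((p (u t))⁻¹ • u t) ≤ s.sup' hne (η τ) := le_of_le_one hs
          (fun v hv => Finset.le_sup' (η τ) hv) (by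
            rw [map_smul_eq_mul, Real.norm_eq_abs, abs_of_pos (inv_pos.2 hpos),
              inv_mul_cancel₀ hpos.ne'])
        rw [map_smul, smul_eq_mul] at h4
        rw [Pi.sub_apply, Pi.sub_apply, hsup, hval, sq, inv_mul_cancel_left₀ hpos.ne', sub_self]
        linarith
      have h5 := hmin.hasDerivAt_eq_zero hg
      rw [mul_zero, sub_zero] at h5
      rwa [h5] at hder)
  rw [uIcc_of_le zero_le_one] at hr
  refine ⟨r, ?_, hr⟩
  rw [← hr 0 (by simp)]
  exact sup'_apply_nonneg hs hne _

end PolyhedralNorm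

/-! ### Comparison of seminorms and norms in finite dimension. -/

section FiniteDimensional

variable {W W' : Type*} [AddCommGroup W] [Module ℝ W] [FiniteDimensional ℝ W] [AddCommGroup W']
  [Module ℝ W'] [FiniteDimensional ℝ W']

theorem IsNorm.exists_abs_le {p : Seminorm ℝ W} (hp : IsNorm p) (f : Module.Dual ℝ W) :
    ∃ C, 0 ≤ C ∧ ∀ x, |f x| ≤ C * p x := by
  let q : AddGroupNorm W := { p.toAddGroupSeminorm with eq_zero_of_map_eq_zero' := hp }
  let _ : NormedAddCommGroup W := q.toNormedAddCommGroup
  let _ : NormedSpace ℝ W := { norm_smul_le := fun c x => (map_smul_eq_mul p c x).le }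
  refine ⟨‖LinearMap.toContinuousLinearMap f‖, norm_nonneg _, fun x => ?_⟩
  exact (LinearMap.toContinuousLinearMap f).le_opNorm x

theorem IsNorm.exists_abs_bilin_le {p : Seminorm ℝ W} (hp : IsNorm p) {q : Seminorm ℝ W'}
    (hq : IsNorm q) (B : W →ₗ[ℝ] W' →ₗ[ℝ] ℝ) :
    ∃ C, 0 ≤ C ∧ ∀ x y, |B x y| ≤ C * (p x * q y) := by
  let b := Module.finBasis ℝ W
  choose C hC0 hC using fun i => hp.exists_abs_le (b.coord i)
  choose D hD0 hD using fun i => hq.exists_abs_le (B (b i))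
  refine ⟨∑ i, C i * D i, Finset.sum_nonneg fun i _ => mul_nonneg (hC0 i) (hD0 i), fun x y => ?_⟩
  have hx : B x y = ∑ i, b.coord i x * B (b i) y := by
    conv_lhs => rw [← b.sum_repr x]
    simp only [map_sum, map_smul, LinearMap.sum_apply, LinearMap.smul_apply, smul_eq_mul,
      Module.Basis.coord_apply]
  rw [hx, Finset.sum_mul]
  refine (Finset.abs_sum_le_sum_abs _ _).trans (Finset.sum_le_sum fun i _ => ?_)
  rw [abs_mul, show C i * D i * (p x * q y) = (C i * p x) * (D i * q y) by ring]
  exact mul_le_mul (hC i x) (hD i y) (abs_nonneg _) (mul_nonneg (hC0 i) (apply_nonneg p x))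

theorem IsNorm.exists_seminorm_le {p : Seminorm ℝ W} (hp : IsNorm p) (q : Seminorm ℝ W) :
    ∃ C, 0 ≤ C ∧ ∀ x, q x ≤ C * p x := by
  let b := Module.finBasis ℝ W
  choose C hC0 hC using fun i => hp.exists_abs_le (b.coord i)
  refine ⟨∑ i, C i * q (b i), Finset.sum_nonneg fun i _ => mul_nonneg (hC0 i) (apply_nonneg q _),
    fun x => ?_⟩
  conv_lhs => rw [← b.sum_repr x]
  refine (Finset.le_sum_of_subadditive q (map_zero q).le (map_add_le_add q) _ _).trans ?_
  rw [Finset.sum_mul]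
  refine Finset.sum_le_sum fun i _ => ?_
  rw [map_smul_eq_mul, Real.norm_eq_abs]
  have := mul_le_mul_of_nonneg_right (hC i x) (apply_nonneg q (b i))
  rw [Module.Basis.coord_apply] at this
  linarith

end FiniteDimensional

/-! ### Absolutely continuous curves in a manifold. -/

section Curves

open Filter Topology

variable {E : Type*} [NormedAddCommGroup E] {G : Type*} [TopologicalSpace G] [ChartedSpace E G]

theorem IsACCurve.exists_pos_mapsTo {γ : ℝ → G} (hγ : IsACCurve E γ) {t : ℝ}
    (ht : t ∈ Icc (0 : ℝ) 1) {s : Set G} (hs : s ∈ 𝓝 (γ t)) :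
    ∃ ε > 0, ∀ τ ∈ Icc (0 : ℝ) 1, τ ∈ Metric.ball t ε → γ τ ∈ s := by
  have h := (hγ.1 t ht).eventually hs
  rw [Filter.Eventually, Metric.mem_nhdsWithin_iff] at h
  obtain ⟨ε, hε, hsub⟩ := h
  exact ⟨ε, hε, fun τ h1 h2 => hsub ⟨h2, h1⟩⟩

variable [NormedSpace ℝ E]

/-- The composition of an absolutely continuous curve with a `C^1` function is absolutely
continuous. -/
theorem IsACCurve.absolutelyContinuousOnInterval_comp [IsManifold 𝓘(ℝ, E) 1 G] {F : Type*}
    [NormedAddCommGroup F] [NormedSpace ℝ F] {f : G → F} (hf : ContMDiff 𝓘(ℝ, E) 𝓘(ℝ, F) 1 f)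
    {γ : ℝ → G} (hγ : IsACCurve E γ) :
    AbsolutelyContinuousOnInterval (fun t => f (γ t)) 0 1 := by
  refine AbsolutelyContinuousOnInterval.of_local zero_le_one fun t ht => ?_
  set φ := chartAt E (γ t) with hφ
  have hφs : γ t ∈ φ.source := mem_chart_source E (γ t)
  have hsymm : ContMDiffAt 𝓘(ℝ, E) 𝓘(ℝ, E) 1 φ.symm (φ (γ t)) :=
    (contMDiffOn_chart_symm (I := 𝓘(ℝ, E)) (n := 1) (x := γ t)).contMDiffAt
      (φ.open_target.mem_nhds (φ.map_source hφs))
  have hd : ContDiffAt ℝ 1 (f ∘ φ.symm) (φ (γ t)) :=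
    contMDiffAt_iff_contDiffAt.1 (hf.contMDiffAt.comp _ hsymm)
  obtain ⟨K, U, hU, hK⟩ := hd.exists_lipschitzOnWith
  have hnhds : φ.source ∩ φ ⁻¹' U ∈ 𝓝 (γ t) :=
    inter_mem (φ.open_source.mem_nhds hφs) (φ.continuousAt hφs hU)
  obtain ⟨ε, hε, hmaps⟩ := hγ.exists_pos_mapsTo ht hnhds
  refine ⟨ε, hε, fun c d hcd h1 h2 => ?_⟩
  have hmem : ∀ τ ∈ Icc c d, γ τ ∈ φ.source ∩ φ ⁻¹' U := fun τ hτ => hmaps τ (h1 hτ) (h2 hτ)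
  have hac := hγ.2 (γ t) c d (h1 ⟨le_rfl, hcd⟩).1 hcd (h1 ⟨hcd, le_rfl⟩).2
    fun τ hτ => (hmem τ hτ).1
  refine hac.of_dist_le (K := K) fun x hx y hy => ?_
  rw [uIcc_of_le hcd] at hx hy
  have := hK.dist_le_mul _ (hmem x hx).2 _ (hmem y hy).2
  simpa only [Function.comp_apply, φ.left_inv (hmem x hx).1, φ.left_inv (hmem y hy).1] using this

/-- An absolutely continuous curve with vanishing velocity is constant. -/
theorem IsACCurve.eq_of_ae_hasMFDerivAt_zero [IsManifold 𝓘(ℝ, E) 1 G] {γ : ℝ → G}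
    (hγ : IsACCurve E γ) (h0 : ∀ᵐ t ∂volume.restrict (Icc (0 : ℝ) 1),
      HasMFDerivAt 𝓘(ℝ, ℝ) 𝓘(ℝ, E) γ t 0) {t : ℝ} (ht : t ∈ Icc (0 : ℝ) 1) : γ t = γ 0 := by
  rw [ae_restrict_iff' measurableSet_Icc] at h0
  -- In a chart the zero derivative makes the curve locally constant; connectedness of [0, 1] does
  -- the rest.
  have hloc : IsLocallyConstant fun x : Icc (0 : ℝ) 1 => γ x := by
    rw [IsLocallyConstant.iff_eventually_eq]
    rintro ⟨t, ht⟩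
    set φ := chartAt E (γ t) with hφ
    have hφs : γ t ∈ φ.source := mem_chart_source E (γ t)
    obtain ⟨ε, hε, hmaps⟩ := hγ.exists_pos_mapsTo ht (φ.open_source.mem_nhds hφs)
    filter_upwards [Metric.ball_mem_nhds _ hε] with ⟨x, hx⟩ hxb
    have hsub : uIcc t x ⊆ Icc 0 1 := uIcc_subset_Icc ht hx
    have hsrc : ∀ τ ∈ uIcc t x, γ τ ∈ φ.source := by
      intro τ hτ
      refine hmaps τ (hsub hτ) ?_
      exact (convex_ball t ε).ordConnected.uIcc_subset (Metric.mem_ball_self hε) hxb hτ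
    have hac : AbsolutelyContinuousOnInterval (fun τ => φ (γ τ)) t x := by
      rcases le_total t x with h | h
      · rw [uIcc_of_le h] at hsrc
        exact hγ.2 (γ t) t x ht.1 h hx.2 hsrc
      · rw [uIcc_of_ge h] at hsrc
        exact (hγ.2 (γ t) x t hx.1 h ht.2 hsrc).symm
    obtain ⟨C, hC⟩ := hac.const_of_ae_hasDerivAt_zero (by
      filter_upwards [h0] with τ h1 hτ
      have h2 := (mdifferentiableAt_extChartAt (I := 𝓘(ℝ, E)) (hsrc τ hτ)).hasMFDerivAt
      have h3 : HasFDerivAt (fun τ => φ (γ τ))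
          (modelDeriv (E := E) (extChartAt 𝓘(ℝ, E) (γ t)) (γ τ) ∘L (0 : ℝ →L[ℝ] E)) τ :=
        HasMFDerivAt.hasFDerivAt (h2.comp τ (h1 (hsub hτ)))
      simpa using h3.hasDerivAt)
    refine φ.injOn (hsrc x right_mem_uIcc) hφs ?_
    exact (hC x right_mem_uIcc).trans (hC t left_mem_uIcc).symm
  exact hloc.apply_eq_of_isPreconnected isPreconnected_univ
    (x := ⟨t, ht⟩) (y := ⟨0, by simp⟩) (mem_univ _) (mem_univ _)

end Curves

/-! ### Evolution of Ad and of the covector along horizontal curves. -/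

section HorizontalCurves

open Filter Topology

variable {E : Type*} [NormedAddCommGroup E] [NormedSpace ℝ E]
  {G : Type*} [TopologicalSpace G] [ChartedSpace E G] [Group G] [LieGroup 𝓘(ℝ, E) ∞ G]
  {V : Submodule ℝ (GroupLieAlgebra 𝓘(ℝ, E) G)} {γ : ℝ → G} {u : ℝ → V}

/-- This is what makes the speed of a non-constant normal curve positive. -/
theorem IsHorizontal.eq_of_ae_eq_zero (hγ : IsHorizontal V γ u)
    (hu : ∀ᵐ t ∂volume.restrict (Icc (0 : ℝ) 1), u t = 0) {t : ℝ} (ht : t ∈ Icc (0 : ℝ) 1) :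
    γ t = γ 0 := by
  refine hγ.ac.eq_of_ae_hasMFDerivAt_zero ?_ ht
  filter_upwards [hγ.deriv, hu] with τ h1 h2
  have h3 : mulInvariantVectorField (u τ : GroupLieAlgebra 𝓘(ℝ, E) G) (γ τ) = 0 := by
    rw [h2]
    exact map_zero _
  rwa [h3, ContinuousLinearMap.smulRight_zero] at h1

/-- The reverse triangle inequality, applied to difference quotients. -/
theorem HasDerivAt.norm_deriv_le {F : Type*} [NormedAddCommGroup F] [NormedSpace ℝ F] {f : ℝ → F}
    {f' : F} {c t : ℝ} (hf : HasDerivAt f f' t) (hn : HasDerivAt (fun τ => ‖f τ‖) c t) :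
    c ≤ ‖f'‖ := by
  rw [hasDerivAt_iff_tendsto_slope] at hf hn
  refine le_of_tendsto_of_tendsto hn hf.norm (Eventually.of_forall fun τ => ?_)
  change slope (fun τ => ‖f τ‖) t τ ≤ ‖slope f t τ‖
  rw [slope_def_field, slope_def_module, norm_smul, norm_inv, Real.norm_eq_abs, div_eq_inv_mul]
  refine (le_abs_self _).trans ?_
  rw [abs_mul, abs_inv]
  gcongr
  exact abs_norm_sub_norm_le _ _

variable [FiniteDimensional ℝ E]

/-- The covector `l ∘ Ad_g` restricted to `V`. -/
noncomputable def coadjointRestrict (V : Submodule ℝ (GroupLieAlgebra 𝓘(ℝ, E) G))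
    (l : Module.Dual ℝ (GroupLieAlgebra 𝓘(ℝ, E) G)) (g : G) : Module.Dual ℝ V :=
  l ∘ₗ (Ad g).toLinearMap ∘ₗ V.subtype

theorem IsACCurve.absolutelyContinuousOnInterval_modelAd (hγ : IsACCurve E γ) :
    AbsolutelyContinuousOnInterval (fun t => modelAd (E := E) (γ t)) 0 1 :=
  have : CompleteSpace E := FiniteDimensional.complete ℝ E
  hγ.absolutelyContinuousOnInterval_comp contMDiff_modelAd

theorem IsACCurve.absolutelyContinuousOnInterval_coadjointRestrict (hγ : IsACCurve E γ)
    (l : Module.Dual ℝ (GroupLieAlgebra 𝓘(ℝ, E) G)) (s : Finset V) :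
    AbsolutelyContinuousOnInterval (fun t => fun v : s => coadjointRestrict V l (γ t) v) 0 1 := by
  let l' : E →ₗ[ℝ] ℝ := l
  let Φ : (E →L[ℝ] E) →L[ℝ] (s → ℝ) := ContinuousLinearMap.pi fun v =>
    (LinearMap.toContinuousLinearMap l').comp
      (ContinuousLinearMap.apply ℝ E ((v : V) : GroupLieAlgebra 𝓘(ℝ, E) G))
  exact hγ.absolutelyContinuousOnInterval_modelAd.of_dist_le (K := ‖Φ‖₊)
    fun x _ y _ => Φ.lipschitz.dist_le_mul (modelAd (γ x)) (modelAd (γ y))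

/-- The exceptional null set does not depend on v, so v = u t may be substituted afterwards. -/
theorem IsHorizontal.ae_hasDerivAt_coadjointRestrict (hγ : IsHorizontal V γ u)
    (l : Module.Dual ℝ (GroupLieAlgebra 𝓘(ℝ, E) G)) :
    ∀ᵐ t ∂volume.restrict (Icc (0 : ℝ) 1), ∀ v : V,
      HasDerivAt (fun τ => coadjointRestrict V l (γ τ) v)
        (l (Ad (γ t) ⁅(u t : GroupLieAlgebra 𝓘(ℝ, E) G), (v : GroupLieAlgebra 𝓘(ℝ, E) G)⁆)) t := by
  have : CompleteSpace E := FiniteDimensional.complete ℝ E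
  filter_upwards [hγ.deriv] with t ht v
  let l' : E →ₗ[ℝ] ℝ := l
  let Φ : (E →L[ℝ] E) →L[ℝ] ℝ := (LinearMap.toContinuousLinearMap l').comp
      (ContinuousLinearMap.apply ℝ E (v : GroupLieAlgebra 𝓘(ℝ, E) G))
  have h := Φ.hasFDerivAt.comp_hasDerivAt t (hasDerivAt_modelAd ht)
  refine HasDerivAt.congr_deriv h ?_
  exact congrArg (fun x => l' (modelAd (γ t) x)) (fderiv_chartAd_eq_bracket (E := E) (G := G) _ _)

theorem IsNormalWithCovector.exists_forall_sup'_eq {p : Seminorm ℝ V} {s : Finset V}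
    (hs : {v | p v ≤ 1} = convexHull ℝ (s : Set V)) (hne : s.Nonempty)
    {l : Module.Dual ℝ (GroupLieAlgebra 𝓘(ℝ, E) G)} (h : IsNormalWithCovector V p γ u l) :
    ∃ r, 0 ≤ r ∧ ∀ t ∈ Icc (0 : ℝ) 1, s.sup' hne (coadjointRestrict V l (γ t)) = r := by
  refine exists_forall_sup'_apply_eq hs hne (u := u)
    (h.horizontal.ac.absolutelyContinuousOnInterval_coadjointRestrict l s) h.inclusion ?_
  filter_upwards [h.horizontal.ae_hasDerivAt_coadjointRestrict l] with t ht
  have := ht (u t)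
  -- The derivative in the direction of the control vanishes because [u, u] = 0.
  rwa [GroupLieAlgebra.bracket_def, VectorField.mlieBracket_self, Pi.zero_apply, map_zero,
    map_zero] at this

/-- The adjoint representation is bounded on the balls of the Carnot-Carathéodory distance. -/
theorem exists_norm_modelAd_le {p : Seminorm ℝ V} (hp : IsNorm p) (r : ℝ) :
    ∃ B, ∀ g : G, ccDist V p 1 g ≤ ENNReal.ofReal r → ‖modelAd (E := E) g‖ ≤ B := by
  have : CompleteSpace E := FiniteDimensional.complete ℝ E
  have : FiniteDimensional ℝ (GroupLieAlgebra 𝓘(ℝ, E) G) := inferInstanceAs (FiniteDimensional ℝ E)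
  set D := fderiv ℝ (chartAd E G) (chartOne E G) with hD
  let ν : Seminorm ℝ (GroupLieAlgebra 𝓘(ℝ, E) G) := normSeminorm ℝ E
  obtain ⟨C, hC0, hC⟩ := hp.exists_seminorm_le (ν.comp V.subtype)
  refine ⟨Real.exp (Real.log (1 + ‖modelAd (E := E) (1 : G)‖) +
    (ENNReal.ofReal (‖D‖ * C) * (ENNReal.ofReal r + 1)).toReal), fun g hg => ?_⟩
  -- The infimum need not be attained; the extra 1 leaves room for a curve.
  have hlt : ccDist V p 1 g < ENNReal.ofReal r + 1 :=
    hg.trans_lt (ENNReal.lt_add_right ENNReal.ofReal_ne_top one_ne_zero)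
  simp only [ccDist, iInf_lt_iff] at hlt
  obtain ⟨γ, u, hγ, h0, h1, hlen⟩ := hlt
  -- Grönwall in logarithmic form: ‖Ad_γ‖' is at most a constant times p(u) ‖Ad_γ‖, so f' is bounded
  -- by a multiple of the speed. Adding 1 keeps the logarithm Lipschitz.
  set f : ℝ → ℝ := fun t => Real.log (1 + ‖modelAd (E := E) (γ t)‖) with hf
  have hnac : AbsolutelyContinuousOnInterval (fun t => ‖modelAd (E := E) (γ t)‖) 0 1 :=
    hγ.ac.absolutelyContinuousOnInterval_modelAd.of_dist_le (K := 1) fun x _ y _ => by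
      rw [one_mul, dist_eq_norm (modelAd (E := E) (γ x))]
      exact dist_norm_norm_le _ _
  have hfac : AbsolutelyContinuousOnInterval f 0 1 := by
    refine hnac.of_dist_le (K := 1) fun x _ y _ => ?_
    have key : ∀ a b : ℝ, 0 ≤ a → 0 ≤ b → Real.log (1 + a) - Real.log (1 + b) ≤ |a - b| := by
      intro a b ha hb
      have h1 : Real.log (1 + a) ≤ Real.log ((1 + b) * (1 + |a - b|)) := by
        refine Real.log_le_log (by positivity) ?_
        nlinarith [le_abs_self (a - b), mul_nonneg hb (abs_nonneg (a - b))]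
      rw [Real.log_mul (by positivity) (by positivity)] at h1
      have h2 := Real.log_le_sub_one_of_pos (show 0 < 1 + |a - b| by positivity)
      linarith
    have h1 := key _ _ (norm_nonneg (modelAd (E := E) (γ x))) (norm_nonneg (modelAd (E := E) (γ y)))
    have h2 := key _ _ (norm_nonneg (modelAd (E := E) (γ y))) (norm_nonneg (modelAd (E := E) (γ x)))
    rw [abs_sub_comm] at h2
    rw [one_mul, Real.dist_eq, Real.dist_eq, abs_le]
    constructor <;> linarith
  have hnd := hnac.ae_differentiableAt
  rw [uIcc_of_le zero_le_one, ← ae_restrict_iff' measurableSet_Icc] at hnd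
  have hderiv : ∀ᵐ t ∂volume.restrict (Icc (0 : ℝ) 1),
      HasDerivAt f (deriv (fun t => ‖modelAd (E := E) (γ t)‖) t / (1 + ‖modelAd (E := E) (γ t)‖)) t
      ∧ deriv (fun t => ‖modelAd (E := E) (γ t)‖) t / (1 + ‖modelAd (E := E) (γ t)‖) ≤
        ‖D‖ * C * p (u t) := by
    filter_upwards [hγ.deriv, hnd] with t h2 h3
    have h4 := h3.hasDerivAt
    refine ⟨(h4.const_add 1).log (by positivity), ?_⟩
    have h5 := (hasDerivAt_modelAd h2).norm_deriv_le h4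
    rw [div_le_iff₀ (by positivity)]
    have h6 : ‖modelAd (γ t) ∘L D (u t : GroupLieAlgebra 𝓘(ℝ, E) G)‖ ≤
        ‖modelAd (E := E) (γ t)‖ * (‖D‖ * (C * p (u t))) :=
      (ContinuousLinearMap.opNorm_comp_le _ _).trans (mul_le_mul_of_nonneg_left
        ((D.le_opNorm _).trans (mul_le_mul_of_nonneg_left (hC (u t)) (norm_nonneg D)))
        (norm_nonneg _))
    have h7 : 0 ≤ ‖D‖ * (C * p (u t)) := by positivity
    have h8 := h5.trans h6
    nlinarith
  have hlen' : ∫⁻ t in Icc (0 : ℝ) 1, ENNReal.ofReal (‖D‖ * C * p (u t)) ≤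
      ENNReal.ofReal (‖D‖ * C) * (ENNReal.ofReal r + 1) := by
    have : ∀ t, ENNReal.ofReal (‖D‖ * C * p (u t)) =
        ENNReal.ofReal (‖D‖ * C) * ENNReal.ofReal (p (u t)) :=
      fun t => ENNReal.ofReal_mul (by positivity)
    simp only [this]
    rw [lintegral_const_mul' _ _ ENNReal.ofReal_ne_top]
    gcongr
  have hfin : ENNReal.ofReal (‖D‖ * C) * (ENNReal.ofReal r + 1) ≠ ⊤ :=
    ENNReal.mul_ne_top ENNReal.ofReal_ne_top (by simp)
  have hmain := hfac.sub_le_lintegral zero_le_one hderiv (ne_top_of_le_ne_top hfin hlen')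
  have hmain' := hmain.trans (ENNReal.toReal_mono hfin hlen')
  simp only [hf, h0, h1] at hmain'
  have hpos : 0 < 1 + ‖modelAd (E := E) g‖ := by positivity
  have : 1 + ‖modelAd (E := E) g‖ ≤ Real.exp (Real.log (1 + ‖modelAd (E := E) (1 : G)‖) +
      (ENNReal.ofReal (‖D‖ * C) * (ENNReal.ofReal r + 1)).toReal) := by
    rw [← Real.log_le_iff_le_exp hpos]
    linarith
  linarith

end HorizontalCurves

/-! ### Initial arcs, rescaled to the unit interval. -/

section Reparametrization

open Filter Topology
open scoped NNReal

variable {E : Type*} [NormedAddCommGroup E] [NormedSpace ℝ E]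
  {G : Type*} [TopologicalSpace G] [ChartedSpace E G] [Group G]
  {V : Submodule ℝ (GroupLieAlgebra 𝓘(ℝ, E) G)} {γ : ℝ → G} {u : ℝ → V}

/-- Transfers almost-everywhere statements from a curve to its rescaled initial arc. -/
theorem quasiMeasurePreserving_const_mul_restrict_Icc {t : ℝ} (ht : t ∈ Ioc (0 : ℝ) 1) :
    Measure.QuasiMeasurePreserving (fun x => t * x) (volume.restrict (Icc (0 : ℝ) 1))
      (volume.restrict (Icc (0 : ℝ) 1)) := by
  refine ⟨by fun_prop, ?_⟩
  refine Measure.AbsolutelyContinuous.mk fun A hA h0 => ?_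
  rw [Measure.restrict_apply hA] at h0
  rw [Measure.map_apply (by fun_prop) hA, Measure.restrict_apply (hA.preimage (by fun_prop))]
  refine measure_mono_null (t := (fun x => t * x) ⁻¹' (A ∩ Icc 0 1)) ?_ ?_
  · rintro x ⟨hx1, hx2⟩
    exact ⟨hx1, mul_nonneg ht.1.le hx2.1, mul_le_one₀ ht.2 hx2.1 hx2.2⟩
  · rw [Real.volume_preimage_mul_left ht.1.ne', h0, mul_zero]

/-- The initial part of a horizontal curve is horizontal after an affine reparametrization. -/
theorem IsHorizontal.comp_const_mul (hγ : IsHorizontal V γ u) {t : ℝ} (ht : t ∈ Ioc (0 : ℝ) 1) :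
    IsHorizontal V (fun x => γ (t * x)) (fun x => t • u (t * x)) := by
  have hq := quasiMeasurePreserving_const_mul_restrict_Icc ht
  have hmem : ∀ x ∈ Icc (0 : ℝ) 1, t * x ∈ Icc (0 : ℝ) 1 :=
    fun x hx => ⟨mul_nonneg ht.1.le hx.1, mul_le_one₀ ht.2 hx.1 hx.2⟩
  refine ⟨⟨hγ.ac.1.comp (by fun_prop) hmem, fun x a b ha hab hb hmaps => ?_⟩, ?_, ?_⟩
  · have htab : t * a ≤ t * b := mul_le_mul_of_nonneg_left hab ht.1.le
    have hac := hγ.ac.2 x (t * a) (t * b) (mul_nonneg ht.1.le ha) htab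
      (mul_le_one₀ ht.2 (ha.trans hab) hb) fun τ hτ => by
        have : γ (t * (τ / t)) ∈ (chartAt E x).source :=
          hmaps ⟨(le_div_iff₀' ht.1).2 hτ.1, (div_le_iff₀' ht.1).2 hτ.2⟩
        rwa [mul_div_cancel₀ _ ht.1.ne'] at this
    refine hac.comp_monotone (φ := fun x => t * x) (K := ‖t‖₊)
      (fun x y hxy => mul_le_mul_of_nonneg_left hxy ht.1.le) (lipschitzWith_smul t) fun y hy => ?_
    rw [uIcc_of_le hab] at hy
    rw [uIcc_of_le htab]
    exact ⟨mul_le_mul_of_nonneg_left hy.1 ht.1.le, mul_le_mul_of_nonneg_left hy.2 ht.1.le⟩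
  · exact (hγ.measurable.comp_quasiMeasurePreserving hq).const_smul t
  · filter_upwards [hq.ae hγ.deriv] with x hx
    have h1 : HasMFDerivAt 𝓘(ℝ, ℝ) 𝓘(ℝ, ℝ) (fun x : ℝ => t * x) x (t • (1 : ℝ →L[ℝ] ℝ)) :=
      HasFDerivAt.hasMFDerivAt ((hasFDerivAt_id x).const_mul t)
    have h2 := HasMFDerivAt.comp x hx h1
    have h3 : mulInvariantVectorField ((t • u (t * x) : V) : GroupLieAlgebra 𝓘(ℝ, E) G)
        (γ (t * x)) = t • mulInvariantVectorField
          (u (t * x) : GroupLieAlgebra 𝓘(ℝ, E) G) (γ (t * x)) :=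
      map_smul (mfderiv 𝓘(ℝ, E) 𝓘(ℝ, E) (fun y : G => γ (t * x) * y) 1) t _
    have h4 : ∀ w : E, (1 : ℝ →L[ℝ] ℝ).smulRight (t • w) =
        (1 : ℝ →L[ℝ] ℝ).smulRight w ∘L (t • (1 : ℝ →L[ℝ] ℝ)) := fun w => by ext; simp
    rw [h3]
    exact Eq.mpr (congrArg (HasMFDerivAt 𝓘(ℝ, ℝ) 𝓘(ℝ, E) (fun x => γ (t * x)) x) (h4 _)) h2

/-- The arc up to time t has length t r ≤ r, so a curve of speed r from the identity stays in the
ball where M(r) applies. -/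
theorem IsHorizontal.ccDist_le {p : Seminorm ℝ V} (hγ : IsHorizontal V γ u) {r : ℝ} (hr : 0 ≤ r)
    (hu : ∀ᵐ t ∂volume.restrict (Icc (0 : ℝ) 1), p (u t) = r) {t : ℝ} (ht : t ∈ Ioc (0 : ℝ) 1) :
    ccDist V p (γ 0) (γ t) ≤ ENNReal.ofReal r := by
  refine (iInf₂_le_of_le (fun x => γ (t * x)) (fun x => t • u (t * x)) <|
    iInf₂_le_of_le (hγ.comp_const_mul ht) (by simp) <| iInf_le_of_le (by simp) le_rfl).trans ?_
  have hq := quasiMeasurePreserving_const_mul_restrict_Icc ht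
  calc ∫⁻ x in Icc (0 : ℝ) 1, ENNReal.ofReal (p (t • u (t * x)))
      ≤ ∫⁻ x in Icc (0 : ℝ) 1, ENNReal.ofReal r := by
        refine lintegral_mono_ae ?_
        filter_upwards [hq.ae hu] with x hx
        refine ENNReal.ofReal_le_ofReal ?_
        rw [map_smul_eq_mul, hx, Real.norm_eq_abs, abs_of_pos ht.1]
        exact mul_le_of_le_one_left hr ht.2
    _ = ENNReal.ofReal r := by simp

end Reparametrization

/-! ### Finiteness of M(r) and the bilinear estimate it gives. -/

section AdjointBound

variable {E : Type*} [NormedAddCommGroup E] [NormedSpace ℝ E] [FiniteDimensional ℝ E]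
  {G : Type*} [TopologicalSpace G] [ChartedSpace E G] [Group G] [LieGroup 𝓘(ℝ, E) ∞ G]
  {V : Submodule ℝ (GroupLieAlgebra 𝓘(ℝ, E) G)} {p : Seminorm ℝ V}
  {N : Seminorm ℝ (GroupLieAlgebra 𝓘(ℝ, E) G)}

/-- Writes the bracket through a continuous bilinear map on E, which makes operator norm bounds and
homogeneity available. -/
theorem Ad_bracket_eq (g : G) (X Y : GroupLieAlgebra 𝓘(ℝ, E) G) :
    (Ad g ⁅X, Y⁆ : GroupLieAlgebra 𝓘(ℝ, E) G) =
      modelAd (E := E) g (fderiv ℝ (chartAd E G) (chartOne E G) X Y) := by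
  have : CompleteSpace E := FiniteDimensional.complete ℝ E
  rw [fderiv_chartAd_eq_bracket (E := E) (G := G) X Y]
  rfl

theorem bddAbove_adjointValues (hp : IsNorm p) (hN : IsNorm N) (r : ℝ) :
    BddAbove (adjointValues V p N r) := by
  have : FiniteDimensional ℝ (GroupLieAlgebra 𝓘(ℝ, E) G) := inferInstanceAs (FiniteDimensional ℝ E)
  obtain ⟨B, hB⟩ := exists_norm_modelAd_le (E := E) (G := G) hp r
  let D := fderiv ℝ (chartAd E G) (chartOne E G)
  let ν : Seminorm ℝ (GroupLieAlgebra 𝓘(ℝ, E) G) := normSeminorm ℝ E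
  have hν : IsNorm ν := fun v hv => (norm_eq_zero (E := E)).1 hv
  obtain ⟨C, hC0, hC⟩ := hν.exists_seminorm_le N
  obtain ⟨C', hC0', hC'⟩ := hN.exists_seminorm_le ν
  refine ⟨C * (B * (‖D‖ * C' * C')), ?_⟩
  rintro _ ⟨g, X, Y, hg, hX, hY, rfl⟩
  have hX' : ν X ≤ C' := by simpa [hX] using hC' X
  have hY' : ν Y ≤ C' := by simpa [hY] using hC' Y
  have hB0 : 0 ≤ B := (norm_nonneg _).trans (hB g hg)
  have h1 : ∀ x y : E, ‖x‖ ≤ C' → ‖y‖ ≤ C' →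
      ‖modelAd (E := E) g (D x y)‖ ≤ B * (‖D‖ * C' * C') := fun x y hx hy =>
    calc ‖modelAd (E := E) g (D x y)‖
        ≤ ‖modelAd (E := E) g‖ * ‖D x y‖ := (modelAd (E := E) g).le_opNorm _
      _ ≤ B * (‖D‖ * ‖x‖ * ‖y‖) := by
        gcongr
        · exact hB g hg
        · exact D.le_opNorm₂ _ _
      _ ≤ B * (‖D‖ * C' * C') := by gcongr
  rw [Ad_bracket_eq]
  exact (hC _).trans (mul_le_mul_of_nonneg_left (h1 X Y hX' hY') hC0)

theorem Ad_bracket_smul_smul (g : G) (a b : ℝ) (X Y : GroupLieAlgebra 𝓘(ℝ, E) G) :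
    (Ad g ⁅a • X, b • Y⁆ : GroupLieAlgebra 𝓘(ℝ, E) G) =
      (a * b) • (Ad g ⁅X, Y⁆ : GroupLieAlgebra 𝓘(ℝ, E) G) := by
  have h : ∀ x y : E, modelAd (E := E) g (fderiv ℝ (chartAd E G) (chartOne E G) (a • x) (b • y)) =
      (a * b) • modelAd (E := E) g (fderiv ℝ (chartAd E G) (chartOne E G) x y) := by
    intro x y
    simp only [map_smul, smul_apply, smul_smul, mul_comm]
  rw [Ad_bracket_eq, Ad_bracket_eq]
  exact h X Y

/-- Homogeneity extends the bound from unit vectors; vectors of norm zero are zero and are treated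
apart. -/
theorem apply_Ad_bracket_le (hp : IsNorm p) (hN : IsNorm N) {r : ℝ} {g : G}
    (hg : ccDist V p 1 g ≤ ENNReal.ofReal r) (X Y : GroupLieAlgebra 𝓘(ℝ, E) G) :
    N (Ad g ⁅X, Y⁆) ≤ adjointBound V p N r * (N X * N Y) := by
  by_cases hX : N X = 0
  · have h := Ad_bracket_smul_smul g 0 1 X Y
    rw [zero_smul, one_smul, zero_mul, zero_smul, ← hN X hX] at h
    rw [h, hX]
    simp
  by_cases hY : N Y = 0
  · have h := Ad_bracket_smul_smul g 1 0 X Y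
    rw [zero_smul, one_smul, mul_zero, zero_smul, ← hN Y hY] at h
    rw [h, hY]
    simp
  have hunit : ∀ Z, N Z ≠ 0 → N ((N Z)⁻¹ • Z) = 1 := by
    intro Z hZ
    rw [map_smul_eq_mul, norm_inv, Real.norm_of_nonneg (apply_nonneg N Z), inv_mul_cancel₀ hZ]
  have hle : N (Ad g ⁅(N X)⁻¹ • X, (N Y)⁻¹ • Y⁆) ≤ adjointBound V p N r :=
    le_csSup (bddAbove_adjointValues hp hN r) ⟨g, _, _, hg, hunit X hX, hunit Y hY, rfl⟩
  rw [Ad_bracket_smul_smul, map_smul_eq_mul, norm_mul, norm_inv, norm_inv,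
    Real.norm_of_nonneg (apply_nonneg N X), Real.norm_of_nonneg (apply_nonneg N Y), ← mul_inv,
    inv_mul_le_iff₀ (mul_pos ((apply_nonneg N X).lt_of_ne' hX)
      ((apply_nonneg N Y).lt_of_ne' hY)), mul_comm] at hle
  exact hle

end AdjointBound

/-! ### The two statements about normal curves. -/

section NormalCurves

variable {E : Type*} [NormedAddCommGroup E] [NormedSpace ℝ E] [FiniteDimensional ℝ E]
  {G : Type*} [TopologicalSpace G] [ChartedSpace E G] [Group G] [LieGroup 𝓘(ℝ, E) ∞ G]
  {V : Submodule ℝ (GroupLieAlgebra 𝓘(ℝ, E) G)} {p : Seminorm ℝ V} {s : Finset V}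

/-- On an interval where the covector restricted to `V` varies little, the control of a normal
curve takes values in one face. -/
theorem exists_pos_takesValueInFace_of_isNormalWithCovector
    (hs : {v | p v ≤ 1} = convexHull ℝ (s : Set V)) :
    ∃ δ > 0, ∀ (γ : ℝ → G) (u : ℝ → V) (l : Module.Dual ℝ (GroupLieAlgebra 𝓘(ℝ, E) G)),
      IsNormalWithCovector V p γ u l → ∃ r, 0 ≤ r ∧
        (∀ᵐ t ∂volume.restrict (Icc (0 : ℝ) 1), p (u t) = r) ∧
        (0 < r → ∀ a b : ℝ, 0 ≤ a → a ≤ b → b ≤ 1 →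
          (∀ v ∈ s, ∀ t ∈ Icc a b,
            |coadjointRestrict V l (γ t) v - coadjointRestrict V l (γ a) v| ≤ δ * r) →
          TakesValueInFace p u a b) := by
  obtain ⟨δ, hδ, hface⟩ := exists_pos_takesValueInFace hs
  have hne := nonempty_of_ball_eq hs
  refine ⟨δ, hδ, fun γ u l h => ?_⟩
  obtain ⟨r, hr0, hr⟩ := h.exists_forall_sup'_eq hs hne
  have hspeed : ∀ᵐ t ∂volume.restrict (Icc (0 : ℝ) 1), p (u t) = r := by
    filter_upwards [h.inclusion, ae_restrict_mem measurableSet_Icc] with t h1 h2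
    rw [← hr t h2]
    exact (sup'_apply_eq_of_mem_subdifferential hs hne h1).symm
  refine ⟨r, hr0, hspeed, fun hrpos a b ha hab hb hosc => ?_⟩
  have hsub : Icc a b ⊆ Icc 0 1 := Icc_subset_Icc ha hb
  refine hface r hrpos u (fun t => coadjointRestrict V l (γ t)) a b hab (fun t ht => ?_) ?_ hosc
  · rw [← hr t (hsub ht)]
    refine ⟨fun v hv => Finset.le_sup' _ hv, ?_⟩
    obtain ⟨v, hv, hveq⟩ := Finset.exists_mem_eq_sup' hne (coadjointRestrict V l (γ t))
    exact ⟨v, hv, hveq.symm⟩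
  · refine ae_restrict_of_ae_restrict_of_subset hsub ?_
    filter_upwards [hspeed, h.inclusion] with t h1 h2
    refine ⟨h1, ?_⟩
    rw [← h1]
    exact (apply_eq_and_le_of_mem_subdifferential_energy h2).1

/-- The control of a non-constant normal curve takes values in one face on short intervals. -/
theorem IsNormalCurve.exists_pos_takesValueInFace (hp : IsNorm p) (hpoly : IsPolyhedral p)
    {γ : ℝ → G} {u : ℝ → V} (h : IsNormalCurve V p γ u)
    (hconst : ∃ t ∈ Icc (0 : ℝ) 1, γ t ≠ γ 0) :
    ∃ δ' : ℝ, 0 < δ' ∧ ∀ a b : ℝ, 0 ≤ a → a ≤ b → b ≤ 1 → b - a ≤ δ' →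
      TakesValueInFace p u a b := by
  obtain ⟨s, hs⟩ := hpoly
  obtain ⟨l, h⟩ := h
  obtain ⟨δ, hδ, hface⟩ := exists_pos_takesValueInFace_of_isNormalWithCovector (G := G) hs
  obtain ⟨r, hr0, hspeed, hface⟩ := hface γ u l h
  have hrpos : 0 < r := by
    refine hr0.lt_of_ne' fun hr => ?_
    obtain ⟨t, ht, hne⟩ := hconst
    refine hne (h.horizontal.eq_of_ae_eq_zero ?_ ht)
    filter_upwards [hspeed] with τ hτ
    exact hp _ (hτ.trans hr)
  have hac := h.horizontal.ac.absolutelyContinuousOnInterval_coadjointRestrict l s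
  have hcont := hac.continuousOn
  rw [uIcc_of_le zero_le_one] at hcont
  -- Uniform continuity of the covector on the vertices gives the interval length.
  obtain ⟨ε, hε, huc⟩ := Metric.uniformContinuousOn_iff.1
    (isCompact_Icc.uniformContinuousOn_of_continuous hcont) (δ * r) (by positivity)
  refine ⟨ε / 2, by positivity, fun a b ha hab hb hlen => hface hrpos a b ha hab hb ?_⟩
  intro v hv t ht
  have h1 := huc t ⟨ha.trans ht.1, ht.2.trans hb⟩ a ⟨ha, hab.trans hb⟩ (by
    rw [Real.dist_eq, abs_of_nonneg (sub_nonneg.2 ht.1)]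
    linarith [ht.2])
  exact (dist_le_pi_dist _ _ (⟨v, hv⟩ : s)).trans h1.le

/-- The control of a normal curve of given speed from the identity takes values in one face on
intervals whose length is controlled by the covector and the adjoint representation. -/
theorem exists_pos_forall_takesValueInFace (hp : IsNorm p) (hpoly : IsPolyhedral p)
    {N : Seminorm ℝ (GroupLieAlgebra 𝓘(ℝ, E) G)} (hN : IsNorm N)
    {Nd : Seminorm ℝ (Module.Dual ℝ (GroupLieAlgebra 𝓘(ℝ, E) G))} (hNd : IsNorm Nd) :
    ∃ δ : ℝ, 0 < δ ∧ ∀ r : ℝ, 0 < r → ∀ (γ : ℝ → G) (u : ℝ → V)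
      (l : Module.Dual ℝ (GroupLieAlgebra 𝓘(ℝ, E) G)),
      IsNormalWithCovector V p γ u l → γ 0 = 1 →
      (∀ᵐ t ∂volume.restrict (Icc (0 : ℝ) 1), p (u t) = r) →
      ∀ a b : ℝ, 0 ≤ a → a ≤ b → b ≤ 1 → (b - a) * (Nd l * adjointBound V p N r) ≤ δ →
        TakesValueInFace p u a b := by
  have : FiniteDimensional ℝ (GroupLieAlgebra 𝓘(ℝ, E) G) := inferInstanceAs (FiniteDimensional ℝ E)
  obtain ⟨s, hs⟩ := hpoly
  obtain ⟨δ, hδ, hface⟩ := exists_pos_takesValueInFace_of_isNormalWithCovector (G := G) hs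
  obtain ⟨A, hA0, hA⟩ := hNd.exists_abs_bilin_le hN LinearMap.id
  obtain ⟨C, hC0, hC⟩ := hp.exists_seminorm_le (N.comp V.subtype)
  -- A bounds the pairing of covectors and vectors by Nd and N, and C bounds N by p on V. On
  -- vertices the covector moves at rate at most A C² Nd(l) M r; the 1 keeps the denominator
  -- positive.
  refine ⟨δ / (A * C ^ 2 + 1), by positivity,
    fun r hr γ u l h hγ0 hspeed a b ha hab hb hlen => ?_⟩
  obtain ⟨r', hr0', hspeed', hface⟩ := hface γ u l h
  -- The conserved dual norm is the prescribed speed, as both equal p (u t) at almost every t.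
  have hrr : r' = r := by
    have hnz : volume.restrict (Icc (0 : ℝ) 1) ≠ 0 := by simp
    have : (ae (volume.restrict (Icc (0 : ℝ) 1))).NeBot := ae_neBot.2 hnz
    obtain ⟨t, h1, h2⟩ := (hspeed'.and hspeed).exists
    exact h1.symm.trans h2
  subst hrr
  refine hface hr a b ha hab hb fun v hv t ht => ?_
  set M := adjointBound V p N r' with hM
  have hM0 : 0 ≤ M := by
    refine Real.sSup_nonneg ?_
    rintro _ ⟨g, X, Y, -, -, -, rfl⟩
    exact apply_nonneg N _
  have hac : AbsolutelyContinuousOnInterval (fun τ => coadjointRestrict V l (γ τ) v) 0 1 :=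
    (h.horizontal.ac.absolutelyContinuousOnInterval_coadjointRestrict l s).of_dist_le (K := 1)
      fun x _ y _ => by
        rw [one_mul]
        exact dist_le_pi_dist (fun v : s => coadjointRestrict V l (γ x) v)
          (fun v : s => coadjointRestrict V l (γ y) v) ⟨v, hv⟩
  have hsub : Icc a t ⊆ Icc 0 1 := Icc_subset_Icc ha (ht.2.trans hb)
  have hNv : N (v : GroupLieAlgebra 𝓘(ℝ, E) G) ≤ C :=
    (hC v).trans (mul_le_of_le_one_right hC0 (seminorm_le_one_of_mem hs hv))
  have hbound := (hac.mono (by rwa [uIcc_of_le ht.1, uIcc_of_le zero_le_one])).abs_sub_le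
    (C := A * (Nd l * (M * (C * r' * C)))) ht.1 (ae_restrict_of_ae_restrict_of_subset hsub (by
      -- The distance estimate rescales by τ, so the null set τ = 0 is discarded.
      have hpos : ∀ᵐ τ : ℝ ∂volume.restrict (Icc (0 : ℝ) 1), τ ≠ 0 :=
        ae_restrict_of_ae (by simp [ae_iff, measure_singleton])
      filter_upwards [h.horizontal.ae_hasDerivAt_coadjointRestrict l, hspeed', hpos,
        ae_restrict_mem measurableSet_Icc] with τ h1 h2 h3 h4
      refine ⟨h1 v, (hA l _).trans (mul_le_mul_of_nonneg_left
        (mul_le_mul_of_nonneg_left ?_ (apply_nonneg Nd l)) hA0)⟩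
      have hdist : ccDist V p 1 (γ τ) ≤ ENNReal.ofReal r' := by
        rw [← hγ0]
        exact h.horizontal.ccDist_le hr0' hspeed' ⟨h4.1.lt_of_ne' h3, h4.2⟩
      refine (apply_Ad_bracket_le hp hN hdist _ _).trans (mul_le_mul_of_nonneg_left ?_ hM0)
      have hNu : N (u τ : GroupLieAlgebra 𝓘(ℝ, E) G) ≤ C * r' := h2 ▸ hC (u τ)
      exact mul_le_mul hNu hNv (apply_nonneg N _) (by positivity)))
  refine hbound.trans ?_
  have hK : 0 ≤ Nd l * M := mul_nonneg (apply_nonneg Nd l) hM0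
  have h1 : (t - a) * (Nd l * M) ≤ δ / (A * C ^ 2 + 1) :=
    (mul_le_mul_of_nonneg_right (by linarith [ht.2]) hK).trans hlen
  have h2 : A * C ^ 2 * (δ / (A * C ^ 2 + 1)) ≤ δ := by
    rw [← mul_div_assoc, div_le_iff₀ (by positivity)]
    nlinarith
  calc A * (Nd l * (M * (C * r' * C))) * (t - a)
      = A * C ^ 2 * ((t - a) * (Nd l * M)) * r' := by ring
    _ ≤ A * C ^ 2 * (δ / (A * C ^ 2 + 1)) * r' := by gcongr
    _ ≤ δ * r' := by gcongr

end NormalCurves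

theorem theorem1p2
    {E : Type*} [NormedAddCommGroup E] [NormedSpace ℝ E] [FiniteDimensional ℝ E]
    {G : Type*} [TopologicalSpace G] [ChartedSpace E G] [Group G] [LieGroup 𝓘(ℝ, E) ∞ G]
    (V : Submodule ℝ (GroupLieAlgebra 𝓘(ℝ, E) G)) (hV : IsBracketGenerating V)
    (p : Seminorm ℝ V) (hp : IsNorm p) (hpoly : IsPolyhedral p) :
    (∀ (γ : ℝ → G) (u : ℝ → V), IsNormalCurve V p γ u → (∃ t ∈ Set.Icc (0 : ℝ) 1, γ t ≠ γ 0) →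
      ∃ δ' : ℝ, 0 < δ' ∧ ∀ a b : ℝ, 0 ≤ a → a ≤ b → b ≤ 1 → b - a ≤ δ' →
        TakesValueInFace p u a b) ∧
    (∀ (N : Seminorm ℝ (GroupLieAlgebra 𝓘(ℝ, E) G)), IsNorm N →
      ∀ (Nd : Seminorm ℝ (Module.Dual ℝ (GroupLieAlgebra 𝓘(ℝ, E) G))), IsNorm Nd →
        (∀ r : ℝ, 0 < r → BddAbove (adjointValues V p N r)) ∧
        ∃ δ : ℝ, 0 < δ ∧ ∀ r : ℝ, 0 < r → ∀ (γ : ℝ → G) (u : ℝ → V)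
          (l : Module.Dual ℝ (GroupLieAlgebra 𝓘(ℝ, E) G)),
          IsNormalWithCovector V p γ u l → γ 0 = 1 →
          (∀ᵐ t ∂MeasureTheory.volume.restrict (Set.Icc (0 : ℝ) 1), p (u t) = r) →
          ∀ a b : ℝ, 0 ≤ a → a ≤ b → b ≤ 1 → (b - a) * (Nd l * adjointBound V p N r) ≤ δ →
            TakesValueInFace p u a b) := by
  exact ⟨fun γ u h hconst => h.exists_pos_takesValueInFace hp hpoly hconst, fun N hN Nd hNd =>
    ⟨fun r _ => bddAbove_adjointValues hp hN r,
      exists_pos_forall_takesValueInFace hp hpoly hN hNd⟩⟩
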